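/- For $n\ge 1$, a matrix from the Gaussian Unitary Ensemble (GUE) of size $n$ is a random Hermitian $n\times n$ matrix whose diagonal entries are real Gaussian variables of mean $0$ and variance $1$, and whose entries above the diagonal have real and imaginary parts that are Gaussian of mean $0$ and variance $1/2$, all these variables being independent. Let $t\in[0,1]$. For every $n\ge 1$ let $X_n$ and $Y_n$ be independent GUE matrices of size $n$, let $$A_{n,t}=\sqrt{\tfrac{1+t}{2}}\,X_n+i\sqrt{\tfrac{1-t}{2}}\,Y_n ,$$ and for $z$ in the open unit disk $\mathbb D=\{z\in\mathbb C:|z|<1\}$ let $$f_{n,t}(z)=\det\Big(1+tz^2-\frac{z}{\sqrt n}A_{n,t}\Big)\,e^{-ntz^2/2}.$$ Let $\mathcal H(\mathbb D)$ be the space of holomorphic functions on $\mathbb D$ with the topology of uniform convergence on compact subsets of $\mathbb D$ and its Borel $\sigma$-algebra. Then the $f_{n,t}$, $n\ge 1$, are random elements of $\mathcal H(\mathbb D)$, and the sequence $\{f_{n,t}\}_{n\ge1}$ is tight: for every $\varepsilon>0$ there is a compact set $K\subset\mathcal H(\mathbb D)$ such that $\mathbb P(f_{n,t}\notin K)\le\varepsilon$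 for every $n\ge 1$. -/

import Mathlib

open MeasureTheory ProbabilityTheory

noncomputable section

namespace EllipticGinibre

/-- The open unit disk. -/
abbrev disk : Set ℂ := Metric.ball (0 : ℂ) 1

/-- `H(𝔻)`: the functions `𝔻 → ℂ` that are holomorphic on the open unit disk. -/
def HolD : Type :=
  {f : C(disk, ℂ) // ∃ g : ℂ → ℂ, DifferentiableOn ℂ g disk ∧ ∀ z : disk, f z = g z}

/-- The topology of uniform convergence on compact subsets of the disk, which is the
compact-open topology. -/
instance : TopologicalSpace HolD :=
  inferInstanceAs (TopologicalSpace
    {f : C(disk, ℂ) // ∃ g : ℂ → ℂ, DifferentiableOn ℂ g disk ∧ ∀ z : disk, f z = g z})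

instance : MeasurableSpace HolD := borel HolD

instance : BorelSpace HolD := ⟨rfl⟩

/-- The element of `H(𝔻)` given by a function on `ℂ` that is holomorphic on the disk. -/
def HolD.ofDifferentiableOn (g : ℂ → ℂ) (hg : DifferentiableOn ℂ g disk) : HolD :=
  ⟨⟨fun z => g z, continuousOn_iff_continuous_domRestrict.1 hg.continuousOn⟩,
    g, hg, fun _ => rfl⟩

/-- Complex matrices carry the product σ-algebra of their entries. -/
instance (n : ℕ) : MeasurableSpace (Matrix (Fin n) (Fin n) ℂ) :=
  inferInstanceAs (MeasurableSpace (Fin n → Fin n → ℂ))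

/-- The Hermitian matrix with diagonal entries `g (i, i)` and with entries
`(g (i, j) + 𝐢 g (j, i)) / √2` above the diagonal. -/
def hermitianOf {n : ℕ} (g : Fin n × Fin n → ℝ) : Matrix (Fin n) (Fin n) ℂ :=
  Matrix.of fun i j =>
    if i = j then (g (i, i) : ℂ)
    else if i < j then ((g (i, j) : ℂ) + Complex.I * (g (j, i) : ℂ)) / (Real.sqrt 2 : ℂ)
    else ((g (j, i) : ℂ) - Complex.I * (g (i, j) : ℂ)) / (Real.sqrt 2 : ℂ)

/-- The law of the Gaussian Unitary Ensemble of size `n`: a Hermitian matrix whose diagonal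
entries are standard real Gaussians and whose entries above the diagonal have independent
centred Gaussian real and imaginary parts of variance `1/2`, all of these independent. -/
def gue (n : ℕ) : Measure (Matrix (Fin n) (Fin n) ℂ) :=
  (Measure.pi fun _ : Fin n × Fin n => gaussianReal 0 1).map hermitianOf

theorem measurable_hermitianOf (n : ℕ) : Measurable (hermitianOf (n := n)) := by
  refine measurable_pi_lambda _ fun i => measurable_pi_lambda _ fun j => ?_
  simp only [hermitianOf, Matrix.of_apply]
  split_ifs <;> fun_prop

instance (n : ℕ) : IsProbabilityMeasure (gue n) :=
  Measure.isProbabilityMeasure_map (measurable_hermitianOf n).aemeasurable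

/-- `A_{n,t} = √((1+t)/2) X + 𝐢 √((1-t)/2) Y`, which for independent `X`, `Y` with law `gue n`
is a matrix of the Elliptic Ginibre Ensemble. -/
def ellipticMatrix {n : ℕ} (t : ℝ) (X Y : Matrix (Fin n) (Fin n) ℂ) :
    Matrix (Fin n) (Fin n) ℂ :=
  (Real.sqrt ((1 + t) / 2) : ℂ) • X + (Complex.I * (Real.sqrt ((1 - t) / 2) : ℂ)) • Y

/-- `z ↦ det(1 + t z² - (z / √n) A) exp(- n t z² / 2)`. -/
def normCharFun {n : ℕ} (t : ℝ) (A : Matrix (Fin n) (Fin n) ℂ) (z : ℂ) : ℂ :=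
  Matrix.det ((1 + (t : ℂ) * z ^ 2) • (1 : Matrix (Fin n) (Fin n) ℂ)
      - (z / (Real.sqrt n : ℂ)) • A)
    * Complex.exp (-((n : ℂ) * (t : ℂ) * z ^ 2 / 2))

theorem differentiable_normCharFun {n : ℕ} (t : ℝ) (A : Matrix (Fin n) (Fin n) ℂ) :
    Differentiable ℂ (normCharFun t A) := by
  unfold normCharFun
  simp only [Matrix.det_apply, Matrix.sub_apply, Matrix.smul_apply, smul_eq_mul]
  fun_prop

/-- The normalised characteristic polynomial of `A`, as an element of `H(𝔻)`. -/
def normCharPoly {n : ℕ} (t : ℝ) (A : Matrix (Fin n) (Fin n) ℂ) : HolD :=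
  HolD.ofDifferentiableOn (normCharFun t A) (differentiable_normCharFun t A).differentiableOn

end EllipticGinibre

end

/-!
Every linear functional `ℓ` of the characteristic polynomial of an elliptic matrix has an exact
second moment. Delete row and column `j`. The characteristic polynomial is a combination of `1`,
`A j j` and the Wick products of an entry of row `j` with an entry of column `j`, which are
orthonormal, and the coefficients depend only on the remaining, independent, matrix. Pythagoras
gives a recursion in the size of the matrix, in which the derivative produced by Wick ordering
turns multiplication by `X` into the operator raising the index of the Hermite polynomials `He_k`
of variance `t`; it is solved by `𝔼 |ℓ(charpoly)|² = ∑ₖ (n! / k!) |ℓ(He_k)|²`.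

Evaluating at the point corresponding to `z`, a Cauchy estimate for the generating function of the
`He_k` on the circle with the optimal radius and Stirling's formula bound the second moment of
`normCharFun t A z` uniformly in `n`, locally uniformly on the disk. As the functions are
holomorphic, their suprema on compact subsets are controlled by circle averages, so Markov's
inequality and Montel's theorem give tightness.
-/

noncomputable section

/-! ### Bordered matrices -/

namespace EllipticGinibre

open Polynomial

section Bordered

variable {R : Type*} [CommRing R] {n : ℕ}

/-- The principal submatrix left when row and column `j` are deleted. The remaining indices are
renumbered by `j.succAbove`. -/
abbrev deleteIndex {R : Type*} {n : ℕ} (B : Matrix (Fin (n + 1)) (Fin (n + 1)) R)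
    (j : Fin (n + 1)) : Matrix (Fin n) (Fin n) R :=
  B.submatrix j.succAbove j.succAbove

theorem adjugate_apply_self (B : Matrix (Fin (n + 1)) (Fin (n + 1)) R) (j : Fin (n + 1)) :
    B.adjugate j j = (deleteIndex B j).det := by
  rw [Matrix.adjugate_fin_succ_eq_det_submatrix, Even.neg_one_pow (Even.add_self _), one_mul]

theorem adjugate_succAbove_apply (B : Matrix (Fin (n + 1)) (Fin (n + 1)) R) (j : Fin (n + 1))
    (i : Fin n) :
    B.adjugate (j.succAbove i) j =
      -∑ k, (deleteIndex B j).adjugate i k * B (j.succAbove k) j := by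
  have swap_columns : (B.updateRow j (Pi.single (j.succAbove i) 1)).submatrix id
        (Equiv.swap j (j.succAbove i)) =
      (B.submatrix id (Equiv.swap j (j.succAbove i))).updateRow j (Pi.single j 1) := by
    ext p q
    by_cases hp : p = j
    · subst hp
      simp [Pi.single_apply, Equiv.swap_apply_eq_iff]
    · simp [hp]
  have deleted : deleteIndex (B.submatrix id (Equiv.swap j (j.succAbove i))) j =
      (deleteIndex B j).updateCol i fun k => B (j.succAbove k) j := by
    ext p q
    by_cases hq : q = i
    · simp [hq]
    · simp [hq, Equiv.swap_apply_of_ne_of_ne (Fin.succAbove_ne j q)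
        (Fin.succAbove_right_injective.ne hq)]
  have h := Matrix.det_permute' (Equiv.swap j (j.succAbove i))
    (B.updateRow j (Pi.single (j.succAbove i) 1))
  rw [swap_columns, ← Matrix.adjugate_apply, ← Matrix.adjugate_apply, adjugate_apply_self, deleted,
    ← Matrix.cramer_apply, Matrix.cramer_eq_adjugate_mulVec,
    Equiv.Perm.sign_swap (Fin.succAbove_ne j i).symm] at h
  simp only [Units.val_neg, Units.val_one, Int.cast_neg, Int.cast_one, neg_one_mul] at h
  rw [← neg_eq_iff_eq_neg, ← h]
  rfl

theorem det_eq_bordered (B : Matrix (Fin (n + 1)) (Fin (n + 1)) R) (j : Fin (n + 1)) :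
    B.det = B j j * (deleteIndex B j).det - ∑ i, ∑ k,
      B j (j.succAbove i) * (deleteIndex B j).adjugate i k * B (j.succAbove k) j := by
  rw [Matrix.det_eq_sum_mul_adjugate_row B j, Fin.sum_univ_succAbove _ j, adjugate_apply_self]
  simp only [adjugate_succAbove_apply, mul_neg, Finset.sum_neg_distrib, Finset.mul_sum, mul_assoc,
    sub_eq_add_neg]

end Bordered

section Charpoly

variable {R : Type*} [CommRing R] {n : ℕ}

theorem derivative_det {ι : Type*} [Fintype ι] [DecidableEq ι] (M : Matrix ι ι R[X]) :
    derivative M.det = ∑ i, (M.updateRow i fun k => derivative (M i k)).det := by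
  have leibniz : ∀ N : Matrix ι ι R[X],
      N.det = ∑ σ : Equiv.Perm ι, C ((Equiv.Perm.sign σ : ℤ) : R) * ∏ i, N i (σ i) := fun N => by
    rw [← Matrix.det_transpose, Matrix.det_apply']
    simp only [Matrix.transpose_apply, map_intCast]
  simp only [leibniz, derivative_sum, derivative_C_mul, derivative_prod_finset]
  rw [Finset.sum_comm]
  refine Finset.sum_congr rfl fun σ _ => ?_
  rw [Finset.mul_sum]
  refine Finset.sum_congr rfl fun i _ => ?_
  rw [← Finset.prod_erase_mul _ _ (Finset.mem_univ i), Matrix.updateRow_self]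
  congr 2
  refine Finset.prod_congr rfl fun k hk => ?_
  rw [Matrix.updateRow_ne (Finset.ne_of_mem_erase hk)]

theorem derivative_charpoly {ι : Type*} [Fintype ι] [DecidableEq ι] (A : Matrix ι ι R) :
    derivative A.charpoly = ∑ i, A.charmatrix.adjugate i i := by
  rw [Matrix.charpoly, derivative_det]
  refine Finset.sum_congr rfl fun i _ => ?_
  rw [Matrix.adjugate_apply]
  congr 2
  ext1 k
  obtain rfl | h := eq_or_ne i k
  · simp
  · simp [h, h.symm]

theorem deleteIndex_charmatrix (A : Matrix (Fin (n + 1)) (Fin (n + 1)) R) (j : Fin (n + 1)) :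
    deleteIndex A.charmatrix j = (deleteIndex A j).charmatrix := by
  ext1 i k
  simp [Matrix.charmatrix_apply, Matrix.diagonal_apply]

theorem adjugate_charmatrix_self (A : Matrix (Fin (n + 1)) (Fin (n + 1)) R) (j : Fin (n + 1)) :
    A.charmatrix.adjugate j j = (deleteIndex A j).charpoly := by
  rw [adjugate_apply_self, deleteIndex_charmatrix, Matrix.charpoly]

theorem adjugate_charmatrix_succAbove (A : Matrix (Fin (n + 1)) (Fin (n + 1)) R)
    (j : Fin (n + 1)) (i : Fin n) :
    A.charmatrix.adjugate (j.succAbove i) j =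
      ∑ k, C (A (j.succAbove k) j) * (deleteIndex A j).charmatrix.adjugate i k := by
  rw [adjugate_succAbove_apply, deleteIndex_charmatrix, ← Finset.sum_neg_distrib]
  refine Finset.sum_congr rfl fun k _ => ?_
  rw [Matrix.charmatrix_apply_ne _ _ _ (Fin.succAbove_ne j k)]
  ring

theorem charpoly_eq_bordered (A : Matrix (Fin (n + 1)) (Fin (n + 1)) R) (j : Fin (n + 1)) :
    A.charpoly = (X - C (A j j)) * (deleteIndex A j).charpoly - ∑ i, ∑ k,
      C (A j (j.succAbove i) * A (j.succAbove k) j) *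
        (deleteIndex A j).charmatrix.adjugate i k := by
  have h := det_eq_bordered A.charmatrix j
  rw [deleteIndex_charmatrix, Matrix.charmatrix_apply_eq] at h
  refine h.trans (congrArg _ ?_)
  refine Finset.sum_congr rfl fun i _ => Finset.sum_congr rfl fun k _ => ?_
  rw [Matrix.charmatrix_apply_ne _ _ _ (Fin.succAbove_ne j i).symm,
    Matrix.charmatrix_apply_ne _ _ _ (Fin.succAbove_ne j k), C_mul]
  ring

end Charpoly

end EllipticGinibre

/-! ### Wick products of a bordering row and column -/

namespace EllipticGinibre

open scoped ComplexConjugate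

section Independence

variable {Ω : Type*} {m₁ m₂ mΩ : MeasurableSpace Ω} {P : Measure Ω}

theorem indepFun_of_indep (h : Indep m₁ m₂ P) {β γ : Type*}
    [MeasurableSpace β] [MeasurableSpace γ] {f : Ω → β} {g : Ω → γ}
    (hf : Measurable[m₁] f) (hg : Measurable[m₂] g) : IndepFun f g P := by
  rw [IndepFun_iff_Indep]
  exact indep_of_indep_of_le_left (indep_of_indep_of_le_right h hg.comap_le) hf.comap_le

theorem measurable_conj {m : MeasurableSpace Ω} {f : Ω → ℂ} (hf : Measurable[m] f) :
    Measurable[m] fun ω => conj (f ω) :=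
  Complex.continuous_conj.measurable.comp hf

theorem integrable_mul_conj {f g : Ω → ℂ} (hf : MemLp f 2 P) (hg : MemLp g 2 P) :
    Integrable (fun ω => f ω * conj (g ω)) P :=
  hf.integrable_mul hg.star

theorem integral_mul_conj_symm (f g : Ω → ℂ) :
    ∫ ω, f ω * conj (g ω) ∂P = conj (∫ ω, g ω * conj (f ω) ∂P) := by
  simp only [← integral_conj, map_mul, Complex.conj_conj, mul_comm]

theorem memLp_two_mul_of_memLp_four {f g : Ω → ℂ} (hf : MemLp f 4 P) (hg : MemLp g 4 P) :
    MemLp (fun ω => f ω * g ω) 2 P := by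
  have : ENNReal.HolderTriple 4 4 2 := ⟨by
    have h : (4 : ENNReal) = 2 * 2 := by norm_num
    rw [h, ENNReal.mul_inv (by simp) (by simp), ← mul_add, ENNReal.inv_two_add_inv_two, mul_one]⟩
  exact hg.mul hf

theorem memLp_two_mul_of_indepFun {f g : Ω → ℂ} (h : IndepFun f g P) (hf : MemLp f 2 P)
    (hg : MemLp g 2 P) : MemLp (fun ω => f ω * g ω) 2 P := by
  rw [memLp_two_iff_integrable_sq_norm (hf.1.fun_mul hg.1)]
  have sq_indep : IndepFun (fun ω => ‖f ω‖ ^ 2) (fun ω => ‖g ω‖ ^ 2) P :=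
    h.comp (measurable_norm.pow_const 2) (measurable_norm.pow_const 2)
  simpa only [norm_mul, mul_pow, Pi.mul_def] using
    sq_indep.integrable_mul hf.norm.integrable_sq hg.norm.integrable_sq

variable {J : Type*} [Fintype J] {K W : J → Ω → ℂ}

theorem memLp_two_sum_mul_of_indep (hind : Indep m₁ m₂ P)
    (hKm : ∀ a, Measurable[m₁] (K a)) (hWm : ∀ a, Measurable[m₂] (W a))
    (hK : ∀ a, MemLp (K a) 2 P) (hW : ∀ a, MemLp (W a) 2 P) :
    MemLp (fun ω => ∑ a, K a ω * W a ω) 2 P :=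
  memLp_finsetSum _ fun a _ =>
    memLp_two_mul_of_indepFun (indepFun_of_indep hind (hKm a) (hWm a)) (hK a) (hW a)

theorem integral_norm_sq_sum_mul_of_orthonormal [DecidableEq J] (hind : Indep m₁ m₂ P)
    (hKm : ∀ a, Measurable[m₁] (K a)) (hWm : ∀ a, Measurable[m₂] (W a))
    (hK : ∀ a, MemLp (K a) 2 P) (hW : ∀ a, MemLp (W a) 2 P)
    (horth : ∀ a b, ∫ ω, W a ω * conj (W b ω) ∂P = if a = b then 1 else 0) :
    ∫ ω, ‖∑ a, K a ω * W a ω‖ ^ 2 ∂P = ∑ a, ∫ ω, ‖K a ω‖ ^ 2 ∂P := by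
  have hi : ∀ a b, IndepFun (fun ω => K a ω * conj (K b ω)) (fun ω => W a ω * conj (W b ω)) P :=
    fun a b => indepFun_of_indep hind ((hKm a).mul (measurable_conj (hKm b)))
      ((hWm a).mul (measurable_conj (hWm b)))
  have hKI := fun a b => integrable_mul_conj (hK a) (hK b)
  have hWI := fun a b => integrable_mul_conj (hW a) (hW b)
  have hI : ∀ a b, Integrable (fun ω => (K a ω * conj (K b ω)) * (W a ω * conj (W b ω))) P :=
    fun a b => (hi a b).integrable_mul (hKI a b) (hWI a b)
  have expand : ∀ ω, ((‖∑ a, K a ω * W a ω‖ ^ 2 : ℝ) : ℂ) =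
      ∑ a, ∑ b, (K a ω * conj (K b ω)) * (W a ω * conj (W b ω)) := fun ω => by
    rw [Complex.ofReal_pow, ← Complex.mul_conj', map_sum, Finset.sum_mul_sum]
    simp only [map_mul, mul_mul_mul_comm]
  apply Complex.ofReal_injective
  rw [← integral_complex_ofReal]
  simp only [expand]
  rw [integral_finsetSum _ fun a _ => integrable_finsetSum _ fun b _ => hI a b,
    Complex.ofReal_sum]
  refine Finset.sum_congr rfl fun a _ => ?_
  have factor : ∀ b, ∫ ω, (K a ω * conj (K b ω)) * (W a ω * conj (W b ω)) ∂P =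
      (∫ ω, K a ω * conj (K b ω) ∂P) * if a = b then 1 else 0 := fun b => by
    rw [(hi a b).integral_fun_mul_eq_mul_integral (hKI a b).1 (hWI a b).1, horth]
  simp only [integral_finsetSum _ fun b _ => hI a b, factor, mul_ite, mul_one, mul_zero,
    Finset.sum_ite_eq, Finset.mem_univ, if_true, ← integral_complex_ofReal, Complex.mul_conj',
    Complex.ofReal_pow]

end Independence

section Border

variable {Ω : Type*} {mΩ : MeasurableSpace Ω} {P : Measure Ω} {κ : Type*}
  {t : ℝ} {r c : κ → Ω → ℂ} {F : Set κ → MeasurableSpace Ω}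

/-- The off-diagonal part of the row and of the column through a diagonal position of an elliptic
matrix: independent pairs `(r i, c i)`, where the σ-algebra `F S` carries the information on the
pairs with index in `S`. -/
structure IsEllipticBorder (t : ℝ) (r c : κ → Ω → ℂ) (F : Set κ → MeasurableSpace Ω)
    (P : Measure Ω) : Prop where
  le : ∀ S, F S ≤ mΩ
  mono : Monotone F
  indep : ∀ S T, Disjoint S T → Indep (F S) (F T) P
  measurable_row : ∀ i, Measurable[F {i}] (r i)
  measurable_col : ∀ i, Measurable[F {i}] (c i)
  memLp_row : ∀ i, MemLp (r i) 4 P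
  memLp_col : ∀ i, MemLp (c i) 4 P
  mean_row : ∀ i, ∫ ω, r i ω ∂P = 0
  mean_col : ∀ i, ∫ ω, c i ω ∂P = 0
  sq_row : ∀ i, ∫ ω, r i ω * conj (r i ω) ∂P = 1
  sq_col : ∀ i, ∫ ω, c i ω * conj (c i ω) ∂P = 1
  cross_conj : ∀ i, ∫ ω, r i ω * conj (c i ω) ∂P = 0
  cross : ∀ i, ∫ ω, r i ω * c i ω ∂P = t
  fourth : ∀ i, ∫ ω, (r i ω * c i ω) * conj (r i ω * c i ω) ∂P = 1 + t ^ 2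

/-- The centred product of an entry of the row with an entry of the column (their Wick product). -/
def wickProd [DecidableEq κ] (t : ℝ) (r c : κ → Ω → ℂ) (i k : κ) (ω : Ω) : ℂ :=
  r i ω * c k ω - if i = k then (t : ℂ) else 0

theorem wickProd_of_ne [DecidableEq κ] {i k : κ} (hik : i ≠ k) (ω : Ω) :
    wickProd t r c i k ω = r i ω * c k ω := by
  rw [wickProd, if_neg hik, sub_zero]

namespace IsEllipticBorder

theorem integral_mul_of_disjoint (h : IsEllipticBorder t r c F P) {S T : Set κ}
    (hST : Disjoint S T) {f g : Ω → ℂ} (hf : Measurable[F S] f) (hg : Measurable[F T] g) :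
    ∫ ω, f ω * g ω ∂P = (∫ ω, f ω ∂P) * ∫ ω, g ω ∂P :=
  (indepFun_of_indep (h.indep _ _ hST) hf hg).integral_fun_mul_eq_mul_integral
    (hf.mono (h.le S) le_rfl).aestronglyMeasurable (hg.mono (h.le T) le_rfl).aestronglyMeasurable

theorem measurable_row_of_mem (h : IsEllipticBorder t r c F P) {S : Set κ} {i : κ} (hi : i ∈ S) :
    Measurable[F S] (r i) :=
  (h.measurable_row i).mono (h.mono (Set.singleton_subset_iff.2 hi)) le_rfl

theorem measurable_col_of_mem (h : IsEllipticBorder t r c F P) {S : Set κ} {i : κ} (hi : i ∈ S) :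
    Measurable[F S] (c i) :=
  (h.measurable_col i).mono (h.mono (Set.singleton_subset_iff.2 hi)) le_rfl

theorem integral_col_mul_conj_col [DecidableEq κ] (h : IsEllipticBorder t r c F P) (i k : κ) :
    ∫ ω, c i ω * conj (c k ω) ∂P = if i = k then 1 else 0 := by
  split_ifs with hik
  · rw [hik, h.sq_col]
  · rw [h.integral_mul_of_disjoint (Set.disjoint_singleton.2 hik) (h.measurable_col i)
      (measurable_conj (h.measurable_col k)), h.mean_col, zero_mul]

theorem memLp_row_mul_col (h : IsEllipticBorder t r c F P) (i k : κ) :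
    MemLp (fun ω => r i ω * c k ω) 2 P :=
  memLp_two_mul_of_memLp_four (h.memLp_row i) (h.memLp_col k)

variable [DecidableEq κ]

theorem measurable_wickProd (h : IsEllipticBorder t r c F P) {i k : κ} {S : Set κ}
    (hi : i ∈ S) (hk : k ∈ S) : Measurable[F S] (wickProd t r c i k) :=
  ((h.measurable_row_of_mem hi).mul (h.measurable_col_of_mem hk)).sub_const _

theorem integral_wickProd_mul_eq_zero (h : IsEllipticBorder t r c F P) {i k : κ} (hik : i ≠ k)
    {S : Set κ} (hS : ¬ (i ∈ S ∧ k ∈ S)) {g : Ω → ℂ} (hg : Measurable[F S] g) :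
    ∫ ω, wickProd t r c i k ω * g ω ∂P = 0 := by
  have hgS : ∀ j, Measurable[F (insert j S)] g := fun j =>
    hg.mono (h.mono (Set.subset_insert j S)) le_rfl
  simp only [wickProd_of_ne hik]
  by_cases hi : i ∈ S
  · have hk : k ∉ insert i S := by grind
    simp only [mul_assoc, mul_left_comm (r i _)]
    rw [h.integral_mul_of_disjoint (Set.disjoint_singleton_left.2 hk) (h.measurable_col k)
      ((h.measurable_row_of_mem (Set.mem_insert i S)).fun_mul (hgS i)), h.mean_col, zero_mul]
  · have hi' : i ∉ insert k S := by grind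
    simp only [mul_assoc]
    rw [h.integral_mul_of_disjoint (Set.disjoint_singleton_left.2 hi') (h.measurable_row i)
      ((h.measurable_col_of_mem (Set.mem_insert k S)).fun_mul (hgS k)), h.mean_row, zero_mul]

theorem integral_wickProd_mul_conj_of_ne_left (h : IsEllipticBorder t r c F P) {i k i' k' : κ}
    (hik : i ≠ k) :
    ∫ ω, wickProd t r c i k ω * conj (wickProd t r c i' k' ω) ∂P =
      if i = i' ∧ k = k' then 1 else 0 := by
  by_cases hS : i ∈ ({i', k'} : Set κ) ∧ k ∈ ({i', k'} : Set κ)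
  · have hdisj : Disjoint ({i} : Set κ) {k} := Set.disjoint_singleton.2 hik
    obtain ⟨rfl, rfl⟩ | ⟨rfl, rfl⟩ : (i = i' ∧ k = k') ∨ (i = k' ∧ k = i') := by grind
    · have regroup : ∀ ω, wickProd t r c i k ω * conj (wickProd t r c i k ω) =
          (r i ω * conj (r i ω)) * (c k ω * conj (c k ω)) := fun ω => by
        rw [wickProd_of_ne hik, map_mul, mul_mul_mul_comm]
      simp only [regroup, and_self, if_true]
      rw [h.integral_mul_of_disjoint hdisj
        ((h.measurable_row i).fun_mul (measurable_conj (h.measurable_row i)))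
        ((h.measurable_col k).fun_mul (measurable_conj (h.measurable_col k))), h.sq_row, h.sq_col,
        mul_one]
    · have regroup : ∀ ω, wickProd t r c i k ω * conj (wickProd t r c k i ω) =
          (r i ω * conj (c i ω)) * (c k ω * conj (r k ω)) := fun ω => by
        rw [wickProd_of_ne hik, wickProd_of_ne hik.symm, mul_comm (r k ω), map_mul,
          mul_mul_mul_comm]
      simp only [regroup]
      rw [h.integral_mul_of_disjoint hdisj
        ((h.measurable_row i).fun_mul (measurable_conj (h.measurable_col i)))
        ((h.measurable_col k).fun_mul (measurable_conj (h.measurable_row k))), h.cross_conj,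
        zero_mul, if_neg (by tauto)]
  · rw [h.integral_wickProd_mul_eq_zero hik hS
      (measurable_conj (h.measurable_wickProd (by simp) (by simp))), if_neg (by grind)]

variable [IsProbabilityMeasure P]

theorem memLp_wickProd (h : IsEllipticBorder t r c F P) (i k : κ) :
    MemLp (wickProd t r c i k) 2 P :=
  (h.memLp_row_mul_col i k).sub (memLp_const _)

theorem integral_wickProd (h : IsEllipticBorder t r c F P) (i k : κ) :
    ∫ ω, wickProd t r c i k ω ∂P = 0 := by
  obtain rfl | hik := eq_or_ne i k
  · simp only [wickProd, if_true]
    rw [integral_sub ((h.memLp_row_mul_col i i).integrable one_le_two) (integrable_const _),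
      h.cross, integral_const, probReal_univ, one_smul, sub_self]
  · simpa only [mul_one] using
      h.integral_wickProd_mul_eq_zero hik (S := ∅) (by simp) (measurable_const (a := (1 : ℂ)))

theorem integral_wickProd_self_mul_conj (h : IsEllipticBorder t r c F P) (i : κ) :
    ∫ ω, wickProd t r c i i ω * conj (wickProd t r c i i ω) ∂P = 1 := by
  have hI := (h.memLp_row_mul_col i i).integrable one_le_two
  have hI4 := integrable_mul_conj (h.memLp_row_mul_col i i) (h.memLp_row_mul_col i i)
  have hw : Integrable (fun ω => conj (wickProd t r c i i ω)) P :=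
    (h.memLp_wickProd i i).star.integrable one_le_two
  have expand : ∀ ω, wickProd t r c i i ω * conj (wickProd t r c i i ω) =
      (r i ω * c i ω) * conj (r i ω * c i ω) - t * (r i ω * c i ω) -
        t * conj (wickProd t r c i i ω) := fun ω => by
    simp only [wickProd, if_true, map_sub, Complex.conj_ofReal]
    ring
  simp only [expand]
  rw [integral_sub (hI4.sub' (hI.const_mul _)) (hw.const_mul _), integral_sub hI4 (hI.const_mul _),
    integral_const_mul, integral_const_mul, h.fourth, h.cross, integral_conj, h.integral_wickProd,
    map_zero]
  ring

theorem integral_wickProd_mul_conj (h : IsEllipticBorder t r c F P) (i k i' k' : κ) :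
    ∫ ω, wickProd t r c i k ω * conj (wickProd t r c i' k' ω) ∂P =
      if i = i' ∧ k = k' then 1 else 0 := by
  by_cases hik : i = k
  · subst hik
    by_cases hik' : i' = k'
    · subst hik'
      obtain rfl | hii := eq_or_ne i i'
      · simpa using h.integral_wickProd_self_mul_conj i
      · rw [h.integral_mul_of_disjoint (Set.disjoint_singleton.2 hii)
          (h.measurable_wickProd rfl rfl) (measurable_conj (h.measurable_wickProd rfl rfl)),
          h.integral_wickProd, zero_mul, if_neg (by tauto)]
    · rw [integral_mul_conj_symm, h.integral_wickProd_mul_conj_of_ne_left hik',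
        if_neg (by grind), if_neg (by grind), map_zero]
  · exact h.integral_wickProd_mul_conj_of_ne_left hik

end IsEllipticBorder

end Border

end EllipticGinibre

/-! ### Elliptic matrices -/

namespace EllipticGinibre

open Polynomial
open scoped ComplexConjugate

section Elliptic

variable {Ω : Type*} {mΩ : MeasurableSpace Ω} {P : Measure Ω} {ι : Type*} {t : ℝ}

/-- The σ-algebra generated by the entries `A i j` with `s(i, j) ∈ S`. Indexing by unordered pairs
keeps `A i j` and `A j i`, which are correlated in an elliptic matrix, in the same block. -/
abbrev blockSigma (A : Ω → Matrix ι ι ℂ) (S : Set (Sym2 ι)) : MeasurableSpace Ω :=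
  ⨆ p : ι × ι, ⨆ _ : s(p.1, p.2) ∈ S, MeasurableSpace.comap (fun ω => A ω p.1 p.2) inferInstance

theorem measurable_blockSigma (A : Ω → Matrix ι ι ℂ) {S : Set (Sym2 ι)} {i j : ι}
    (h : s(i, j) ∈ S) : Measurable[blockSigma A S] fun ω => A ω i j := by
  rw [measurable_iff_comap_le]
  exact le_iSup₂_of_le (f := fun (p : ι × ι) (_ : s(p.1, p.2) ∈ S) =>
    MeasurableSpace.comap (fun ω => A ω p.1 p.2) inferInstance) (i, j) h le_rfl

theorem blockSigma_le {A : Ω → Matrix ι ι ℂ} {S : Set (Sym2 ι)} {m : MeasurableSpace Ω}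
    (h : ∀ i j, s(i, j) ∈ S → Measurable[m] fun ω => A ω i j) : blockSigma A S ≤ m :=
  iSup₂_le fun p hp => (h p.1 p.2 hp).comap_le

theorem blockSigma_mono (A : Ω → Matrix ι ι ℂ) : Monotone (blockSigma A) :=
  fun _ _ hST => blockSigma_le fun _ _ hij => measurable_blockSigma A (hST hij)

/-- A random matrix whose blocks `(A i j, A j i)` are independent and whose entries have the
moments up to order four of the elliptic ensemble of parameter `t`. -/
structure IsElliptic (t : ℝ) (A : Ω → Matrix ι ι ℂ) (P : Measure Ω) : Prop where
  measurable : ∀ i j, Measurable fun ω => A ω i j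
  indep : ∀ S T : Set (Sym2 ι), Disjoint S T → Indep (blockSigma A S) (blockSigma A T) P
  memLp : ∀ i j, MemLp (fun ω => A ω i j) 4 P
  mean : ∀ i j, ∫ ω, A ω i j ∂P = 0
  sq : ∀ i j, ∫ ω, A ω i j * conj (A ω i j) ∂P = 1
  cross_conj : ∀ i j, i ≠ j → ∫ ω, A ω i j * conj (A ω j i) ∂P = 0
  cross : ∀ i j, i ≠ j → ∫ ω, A ω i j * A ω j i ∂P = t
  fourth : ∀ i j, i ≠ j → ∫ ω, (A ω i j * A ω j i) * conj (A ω i j * A ω j i) ∂P = 1 + t ^ 2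

namespace IsElliptic

variable {A : Ω → Matrix ι ι ℂ}

protected theorem blockSigma_le (h : IsElliptic t A P) (S : Set (Sym2 ι)) : blockSigma A S ≤ mΩ :=
  blockSigma_le fun i j _ => h.measurable i j

theorem memLp_two [IsProbabilityMeasure P] (h : IsElliptic t A P) (i j : ι) :
    MemLp (fun ω => A ω i j) 2 P :=
  (h.memLp i j).mono_exponent (by norm_num)

theorem submatrix (h : IsElliptic t A P) {κ : Type*} {e : κ → ι} (he : Function.Injective e) :
    IsElliptic t (fun ω => (A ω).submatrix e e) P where
  measurable i j := h.measurable _ _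
  indep S T hST := by
    have hle : ∀ S : Set (Sym2 κ), blockSigma (fun ω => (A ω).submatrix e e) S ≤
        blockSigma A (Sym2.map e '' S) := fun S => blockSigma_le fun i j hij =>
      measurable_blockSigma A ⟨s(i, j), hij, Sym2.map_mk _ _ _⟩
    exact indep_of_indep_of_le_left (indep_of_indep_of_le_right
      (h.indep _ _ (Set.disjoint_image_of_injective (Sym2.map.injective he) hST)) (hle T)) (hle S)
  memLp i j := h.memLp _ _
  mean i j := h.mean _ _
  sq i j := h.sq _ _
  cross_conj i j hij := h.cross_conj _ _ (he.ne hij)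
  cross i j hij := h.cross _ _ (he.ne hij)
  fourth i j hij := h.fourth _ _ (he.ne hij)

variable {n : ℕ} {A : Ω → Matrix (Fin (n + 1)) (Fin (n + 1)) ℂ}

theorem border (h : IsElliptic t A P) (j : Fin (n + 1)) :
    IsEllipticBorder t (fun i ω => A ω j (j.succAbove i)) (fun i ω => A ω (j.succAbove i) j)
      (fun S => blockSigma A ((fun i => s(j, j.succAbove i)) '' S)) P where
  le _ := h.blockSigma_le _
  mono _ _ hST := blockSigma_mono A (Set.image_mono hST)
  indep _ _ hST := h.indep _ _ (Set.disjoint_image_of_injective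
    (fun _ _ hab => Fin.succAbove_right_injective (Sym2.congr_right.1 hab)) hST)
  measurable_row i := measurable_blockSigma A ⟨i, rfl, rfl⟩
  measurable_col i := measurable_blockSigma A ⟨i, rfl, Sym2.eq_swap⟩
  memLp_row _ := h.memLp _ _
  memLp_col _ := h.memLp _ _
  mean_row _ := h.mean _ _
  mean_col _ := h.mean _ _
  sq_row _ := h.sq _ _
  sq_col _ := h.sq _ _
  cross_conj i := h.cross_conj _ _ (Fin.succAbove_ne j i).symm
  cross i := h.cross _ _ (Fin.succAbove_ne j i).symm
  fourth i := h.fourth _ _ (Fin.succAbove_ne j i).symm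

theorem indep_deleteIndex (h : IsElliptic t A P) (j : Fin (n + 1)) :
    Indep (blockSigma A {b | j ∉ b}) (blockSigma A {b | j ∈ b}) P :=
  h.indep _ _ (Set.disjoint_left.2 fun _ h₁ h₂ => h₁ h₂)

end IsElliptic

end Elliptic

section BorderBasis

variable {Ω : Type*} {mΩ : MeasurableSpace Ω} {P : Measure Ω} {t : ℝ} {n : ℕ}
  {A : Ω → Matrix (Fin (n + 1)) (Fin (n + 1)) ℂ}

/-- The random variables `1`, `A j j` and the Wick products of row and column `j`. They are
orthonormal for an elliptic matrix, and the characteristic polynomial is expanded along them. -/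
def borderBasis (t : ℝ) (A : Ω → Matrix (Fin (n + 1)) (Fin (n + 1)) ℂ) (j : Fin (n + 1)) :
    Option (Option (Fin n × Fin n)) → Ω → ℂ
  | none => fun _ => 1
  | some none => fun ω => A ω j j
  | some (some p) => wickProd t (fun i ω => A ω j (j.succAbove i))
      (fun i ω => A ω (j.succAbove i) j) p.1 p.2

namespace IsElliptic

theorem measurable_borderBasis (h : IsElliptic t A P) (j : Fin (n + 1))
    (a : Option (Option (Fin n × Fin n))) :
    Measurable[blockSigma A {b | j ∈ b}] (borderBasis t A j a) := by
  match a with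
  | none => exact measurable_const
  | some none => exact measurable_blockSigma A (Sym2.mem_mk_left j j)
  | some (some p) =>
    have hsub : (fun i => s(j, j.succAbove i)) '' Set.univ ⊆ {b | j ∈ b} := by
      rintro _ ⟨i, -, rfl⟩
      exact Sym2.mem_mk_left j _
    exact ((h.border j).measurable_wickProd (Set.mem_univ p.1) (Set.mem_univ p.2)).mono
      (blockSigma_mono A hsub) le_rfl

theorem integral_wickProd_mul_conj_diag [IsProbabilityMeasure P] (h : IsElliptic t A P)
    (j : Fin (n + 1)) (p : Fin n × Fin n) :
    ∫ ω, borderBasis t A j (some (some p)) ω * conj (A ω j j) ∂P = 0 := by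
  have hdisj : Disjoint ((fun i => s(j, j.succAbove i)) '' Set.univ) {s(j, j)} := by
    rw [Set.disjoint_singleton_right]
    rintro ⟨i, -, hi⟩
    exact Fin.succAbove_ne j i (Sym2.congr_right.1 hi)
  have hw := (h.border j).measurable_wickProd (Set.mem_univ p.1) (Set.mem_univ p.2)
  have hd := measurable_conj (measurable_blockSigma A (Set.mem_singleton s(j, j)))
  rw [borderBasis, (indepFun_of_indep (h.indep _ _ hdisj) hw hd).integral_fun_mul_eq_mul_integral
    (hw.mono (h.blockSigma_le _) le_rfl).aestronglyMeasurable
    (hd.mono (h.blockSigma_le _) le_rfl).aestronglyMeasurable,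
    (h.border j).integral_wickProd, zero_mul]

theorem integral_borderBasis_mul_conj [IsProbabilityMeasure P] (h : IsElliptic t A P)
    (j : Fin (n + 1)) (a b : Option (Option (Fin n × Fin n))) :
    ∫ ω, borderBasis t A j a ω * conj (borderBasis t A j b ω) ∂P = if a = b then 1 else 0 := by
  have diag_one :
      ∫ ω, borderBasis t A j (some none) ω * conj (borderBasis t A j none ω) ∂P = 0 := by
    simpa only [borderBasis, map_one, mul_one] using h.mean j j
  have wick_one : ∀ p,
      ∫ ω, borderBasis t A j (some (some p)) ω * conj (borderBasis t A j none ω) ∂P = 0 :=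
    fun p => by
      simpa only [borderBasis, map_one, mul_one] using (h.border j).integral_wickProd p.1 p.2
  have wick_diag := h.integral_wickProd_mul_conj_diag j
  match a, b with
  | none, none => simp [borderBasis]
  | some none, none => simpa using diag_one
  | none, some none => rw [integral_mul_conj_symm, diag_one]; simp
  | some (some p), none => rw [wick_one]; simp
  | none, some (some p) => rw [integral_mul_conj_symm, wick_one]; simp
  | some none, some none => simpa [borderBasis] using h.sq j j
  | some (some p), some none => exact (wick_diag p).trans (by simp)
  | some none, some (some p) =>
    rw [integral_mul_conj_symm]
    exact (congrArg conj (wick_diag p)).trans (by simp)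
  | some (some p), some (some q) =>
    simp only [borderBasis, Option.some.injEq, Prod.ext_iff]
    exact (h.border j).integral_wickProd_mul_conj _ _ _ _

theorem memLp_borderBasis [IsProbabilityMeasure P] (h : IsElliptic t A P) (j : Fin (n + 1))
    (a : Option (Option (Fin n × Fin n))) : MemLp (borderBasis t A j a) 2 P :=
  match a with
  | none => memLp_const _
  | some none => h.memLp_two _ _
  | some (some _) => (h.border j).memLp_wickProd _ _

end IsElliptic

end BorderBasis

section Recursion

variable {t : ℝ} {n : ℕ}

/-- The operator `q ↦ X q - t q'`, which raises the index of the Hermite polynomials. -/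
def raiseOp (t : ℝ) : ℂ[X] →ₗ[ℂ] ℂ[X] := LinearMap.mulLeft ℂ X - (t : ℂ) • derivative

theorem raiseOp_apply (t : ℝ) (q : ℂ[X]) : raiseOp t q = X * q - C (t : ℂ) * derivative q := by
  simp [raiseOp, smul_eq_C_mul]

/-- The monic Hermite polynomials of variance `t`; for `t = 1` these are the probabilists' Hermite
polynomials. -/
def hermitePoly (t : ℝ) : ℕ → ℂ[X]
  | 0 => 1
  | k + 1 => raiseOp t (hermitePoly t k)

theorem map_C_mul (ℓ : ℂ[X] →ₗ[ℂ] ℂ) (a : ℂ) (q : ℂ[X]) : ℓ (C a * q) = a * ℓ q := by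
  rw [C_mul', map_smul, smul_eq_mul]

theorem map_charpoly (ℓ : ℂ[X] →ₗ[ℂ] ℂ) (A : Matrix (Fin (n + 1)) (Fin (n + 1)) ℂ)
    (j : Fin (n + 1)) :
    ℓ A.charpoly = ℓ (X * (deleteIndex A j).charpoly) - A j j * ℓ (deleteIndex A j).charpoly -
      ∑ i, ∑ k, A j (j.succAbove i) * A (j.succAbove k) j *
        ℓ ((deleteIndex A j).charmatrix.adjugate i k) := by
  rw [charpoly_eq_bordered A j, sub_mul, map_sub, map_sub, map_C_mul]
  simp only [map_sum, map_C_mul]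

theorem map_adjugate_charmatrix_succAbove (ℓ : ℂ[X] →ₗ[ℂ] ℂ)
    (A : Matrix (Fin (n + 1)) (Fin (n + 1)) ℂ) (j : Fin (n + 1)) (i : Fin n) :
    ℓ (A.charmatrix.adjugate (j.succAbove i) j) =
      ∑ k, ℓ ((deleteIndex A j).charmatrix.adjugate i k) * A (j.succAbove k) j := by
  simp only [adjugate_charmatrix_succAbove, map_sum, map_C_mul, mul_comm (A _ j)]

/-- The coefficients of the expansion of the characteristic polynomial along `borderBasis`, as
functions of the matrix `B` left when the row and the column are deleted. -/
def borderCoeff (t : ℝ) (ℓ : ℂ[X] →ₗ[ℂ] ℂ) (B : Matrix (Fin n) (Fin n) ℂ) :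
    Option (Option (Fin n × Fin n)) → ℂ
  | none => ℓ (raiseOp t B.charpoly)
  | some none => -ℓ B.charpoly
  | some (some p) => -ℓ (B.charmatrix.adjugate p.1 p.2)

-- Centring the products `A j i * A i j` produces the derivative of the smaller characteristic
-- polynomial, the trace of its adjugate, which turns multiplication by `X` into `raiseOp t`.
theorem map_charpoly_eq_sum_borderCoeff {Ω : Type*} (t : ℝ)
    (A : Ω → Matrix (Fin (n + 1)) (Fin (n + 1)) ℂ) (ℓ : ℂ[X] →ₗ[ℂ] ℂ) (j : Fin (n + 1)) (ω : Ω) :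
    ℓ (A ω).charpoly =
      ∑ a, borderCoeff t ℓ (deleteIndex (A ω) j) a * borderBasis t A j a ω := by
  have raise : ℓ (raiseOp t (deleteIndex (A ω) j).charpoly) =
      ℓ (X * (deleteIndex (A ω) j).charpoly) -
        ∑ i, t * ℓ ((deleteIndex (A ω) j).charmatrix.adjugate i i) := by
    rw [raiseOp_apply, map_sub, map_C_mul, derivative_charpoly, map_sum, Finset.mul_sum]
  rw [map_charpoly ℓ _ j, Fintype.sum_option, Fintype.sum_option, Fintype.sum_prod_type]
  simp only [borderCoeff, borderBasis, wickProd, raise, mul_sub, Finset.sum_sub_distrib, mul_ite,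
    mul_zero, Finset.sum_ite_eq, Finset.mem_univ, if_true, neg_mul, mul_one]
  simp only [Finset.sum_neg_distrib, mul_comm]
  ring

variable {Ω : Type*} {m : MeasurableSpace Ω}

theorem measurable_map_charpoly_and_adjugate {A : Ω → Matrix (Fin n) (Fin n) ℂ}
    (hA : ∀ i j, Measurable fun ω => A ω i j) (ℓ : ℂ[X] →ₗ[ℂ] ℂ) :
    (Measurable fun ω => ℓ (A ω).charpoly) ∧
      ∀ i j, Measurable fun ω => ℓ ((A ω).charmatrix.adjugate i j) := by
  induction n generalizing ℓ with
  | zero => exact ⟨by simp only [Matrix.charpoly_isEmpty, measurable_const], fun i => i.elim0⟩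
  | succ n ih =>
    have ih' := fun j => ih (A := fun ω => deleteIndex (A ω) j) fun i k => hA _ _
    constructor
    · simp only [map_charpoly ℓ _ 0]
      refine ((ih' 0 (ℓ ∘ₗ LinearMap.mulLeft ℂ X)).1.sub ((hA 0 0).mul (ih' 0 ℓ).1)).sub ?_
      exact Finset.measurable_fun_sum _ fun i _ => Finset.measurable_fun_sum _ fun k _ =>
        ((hA _ _).mul (hA _ _)).mul ((ih' 0 ℓ).2 i k)
    · intro i j
      obtain rfl | ⟨i, rfl⟩ := Fin.eq_self_or_eq_succAbove j i
      · simp only [adjugate_charmatrix_self]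
        exact (ih' i ℓ).1
      · simp only [map_adjugate_charmatrix_succAbove]
        exact Finset.measurable_fun_sum _ fun k _ => ((ih' j ℓ).2 i k).mul (hA _ _)

end Recursion

end EllipticGinibre

/-! ### Second moments of the characteristic polynomial -/

namespace EllipticGinibre

open Polynomial
open scoped Nat

section Moments

variable {Ω : Type*} {mΩ : MeasurableSpace Ω} {P : Measure Ω} {t : ℝ} {n : ℕ}

theorem measurable_deleteIndex_apply (A : Ω → Matrix (Fin (n + 1)) (Fin (n + 1)) ℂ)
    (j : Fin (n + 1)) (i k : Fin n) : Measurable[blockSigma A {b | j ∉ b}] fun ω =>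
      deleteIndex (A ω) j i k :=
  measurable_blockSigma A (by simp [(Fin.succAbove_ne j _).symm])

theorem measurable_borderCoeff (A : Ω → Matrix (Fin (n + 1)) (Fin (n + 1)) ℂ)
    (ℓ : ℂ[X] →ₗ[ℂ] ℂ) (j : Fin (n + 1)) (a : Option (Option (Fin n × Fin n))) :
    Measurable[blockSigma A {b | j ∉ b}] fun ω => borderCoeff t ℓ (deleteIndex (A ω) j) a :=
  have hmeas := measurable_map_charpoly_and_adjugate (measurable_deleteIndex_apply A j)
  match a with
  | none => (hmeas (ℓ ∘ₗ raiseOp t)).1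
  | some none => (hmeas ℓ).1.neg
  | some (some p) => ((hmeas ℓ).2 p.1 p.2).neg

namespace IsElliptic

protected theorem deleteIndex {A : Ω → Matrix (Fin (n + 1)) (Fin (n + 1)) ℂ}
    (h : IsElliptic t A P) (j : Fin (n + 1)) : IsElliptic t (fun ω => deleteIndex (A ω) j) P :=
  h.submatrix Fin.succAbove_right_injective

variable [IsProbabilityMeasure P]

theorem memLp_map_charpoly_and_adjugate {A : Ω → Matrix (Fin n) (Fin n) ℂ}
    (hA : IsElliptic t A P) (ℓ : ℂ[X] →ₗ[ℂ] ℂ) :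
    MemLp (fun ω => ℓ (A ω).charpoly) 2 P ∧
      ∀ i j, MemLp (fun ω => ℓ ((A ω).charmatrix.adjugate i j)) 2 P := by
  induction n generalizing ℓ with
  | zero => exact ⟨by simp only [Matrix.charpoly_isEmpty, memLp_const], fun i => i.elim0⟩
  | succ n ih =>
    have ih' := fun j => ih (hA.deleteIndex j)
    constructor
    · simp only [map_charpoly_eq_sum_borderCoeff t A ℓ 0]
      refine memLp_two_sum_mul_of_indep (hA.indep_deleteIndex 0) (measurable_borderCoeff A ℓ 0)
        (hA.measurable_borderBasis 0) (fun a => ?_) (hA.memLp_borderBasis 0)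
      match a with
      | none => exact (ih' 0 (ℓ ∘ₗ raiseOp t)).1
      | some none => exact (ih' 0 ℓ).1.neg
      | some (some p) => exact ((ih' 0 ℓ).2 p.1 p.2).neg
    · intro i j
      obtain rfl | ⟨i, rfl⟩ := Fin.eq_self_or_eq_succAbove j i
      · simp only [adjugate_charmatrix_self]
        exact (ih' i ℓ).1
      · simp only [map_adjugate_charmatrix_succAbove]
        exact memLp_two_sum_mul_of_indep (hA.indep_deleteIndex j)
          (fun k =>
            (measurable_map_charpoly_and_adjugate (measurable_deleteIndex_apply A j) ℓ).2 i k)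
          (fun k => measurable_blockSigma A (Sym2.mem_mk_right _ _)) ((ih' j ℓ).2 i)
          fun k => hA.memLp_two _ _

section Step

variable {A : Ω → Matrix (Fin (n + 1)) (Fin (n + 1)) ℂ}

theorem memLp_borderCoeff (hA : IsElliptic t A P) (ℓ : ℂ[X] →ₗ[ℂ] ℂ) (j : Fin (n + 1))
    (a : Option (Option (Fin n × Fin n))) :
    MemLp (fun ω => borderCoeff t ℓ (deleteIndex (A ω) j) a) 2 P :=
  have hmem := (hA.deleteIndex j).memLp_map_charpoly_and_adjugate
  match a with
  | none => (hmem (ℓ ∘ₗ raiseOp t)).1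
  | some none => (hmem ℓ).1.neg
  | some (some p) => ((hmem ℓ).2 p.1 p.2).neg

theorem integral_norm_sq_map_charpoly_succ (hA : IsElliptic t A P) (ℓ : ℂ[X] →ₗ[ℂ] ℂ)
    (j : Fin (n + 1)) :
    ∫ ω, ‖ℓ (A ω).charpoly‖ ^ 2 ∂P =
      ∫ ω, ‖ℓ (raiseOp t (deleteIndex (A ω) j).charpoly)‖ ^ 2 ∂P +
        (∫ ω, ‖ℓ (deleteIndex (A ω) j).charpoly‖ ^ 2 ∂P +
          ∑ i, ∑ k, ∫ ω, ‖ℓ ((deleteIndex (A ω) j).charmatrix.adjugate i k)‖ ^ 2 ∂P) := by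
  simp only [map_charpoly_eq_sum_borderCoeff t A ℓ j]
  rw [integral_norm_sq_sum_mul_of_orthonormal (hA.indep_deleteIndex j)
    (measurable_borderCoeff A ℓ j) (hA.measurable_borderBasis j) (hA.memLp_borderCoeff ℓ j)
    (hA.memLp_borderBasis j) (hA.integral_borderBasis_mul_conj j), Fintype.sum_option,
    Fintype.sum_option, Fintype.sum_prod_type]
  simp only [borderCoeff, norm_neg]

theorem integral_norm_sq_map_adjugate_succAbove (hA : IsElliptic t A P) (ℓ : ℂ[X] →ₗ[ℂ] ℂ)
    (j : Fin (n + 1)) (i : Fin n) :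
    ∫ ω, ‖ℓ ((A ω).charmatrix.adjugate (j.succAbove i) j)‖ ^ 2 ∂P =
      ∑ k, ∫ ω, ‖ℓ ((deleteIndex (A ω) j).charmatrix.adjugate i k)‖ ^ 2 ∂P := by
  simp only [map_adjugate_charmatrix_succAbove]
  exact integral_norm_sq_sum_mul_of_orthonormal (hA.indep_deleteIndex j)
    (fun k => (measurable_map_charpoly_and_adjugate (measurable_deleteIndex_apply A j) ℓ).2 i k)
    (fun k => measurable_blockSigma A (Sym2.mem_mk_right _ _))
    (((hA.deleteIndex j).memLp_map_charpoly_and_adjugate ℓ).2 i) (fun k => hA.memLp_two _ _)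
    (hA.border j).integral_col_mul_conj_col

end Step

end IsElliptic

/-- The second moment of `ℓ` at the characteristic polynomial of an elliptic matrix of
size `n`. -/
def charpolyMoment (t : ℝ) (ℓ : ℂ[X] →ₗ[ℂ] ℂ) (n : ℕ) : ℝ :=
  ∑ k ∈ Finset.range (n + 1), (n ! : ℝ) / k ! * ‖ℓ (hermitePoly t k)‖ ^ 2

/-- The sum of the second moments of `ℓ` at the entries of the adjugate of the characteristic
matrix of an elliptic matrix of size `n`. -/
def adjugateMoment (t : ℝ) (ℓ : ℂ[X] →ₗ[ℂ] ℂ) (n : ℕ) : ℝ :=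
  ∑ k ∈ Finset.range (n + 1), (n ! : ℝ) / k ! * (n - k) * ‖ℓ (hermitePoly t k)‖ ^ 2

theorem adjugateMoment_succ (t : ℝ) (ℓ : ℂ[X] →ₗ[ℂ] ℂ) (n : ℕ) :
    adjugateMoment t ℓ (n + 1) = (n + 1) * (charpolyMoment t ℓ n + adjugateMoment t ℓ n) := by
  rw [adjugateMoment, Finset.sum_range_succ, charpolyMoment, adjugateMoment,
    ← Finset.sum_add_distrib, Finset.mul_sum]
  simp only [sub_self, mul_zero, zero_mul, add_zero, Nat.factorial_succ]
  refine Finset.sum_congr rfl fun k _ => ?_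
  push_cast
  ring

theorem charpolyMoment_succ (t : ℝ) (ℓ : ℂ[X] →ₗ[ℂ] ℂ) (n : ℕ) :
    charpolyMoment t ℓ (n + 1) = charpolyMoment t (ℓ ∘ₗ raiseOp t) n +
      (charpolyMoment t ℓ n + adjugateMoment t ℓ n) := by
  have raised : charpolyMoment t (ℓ ∘ₗ raiseOp t) n =
      ∑ k ∈ Finset.range (n + 2), (n ! : ℝ) / k ! * k * ‖ℓ (hermitePoly t k)‖ ^ 2 := by
    rw [Finset.sum_range_succ']
    simp only [Nat.cast_zero, mul_zero, zero_mul, add_zero, charpolyMoment]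
    refine Finset.sum_congr rfl fun k _ => ?_
    simp only [LinearMap.comp_apply, hermitePoly, Nat.factorial_succ]
    push_cast
    field_simp
  have rest : charpolyMoment t ℓ n + adjugateMoment t ℓ n =
      ∑ k ∈ Finset.range (n + 2), (n ! : ℝ) / k ! * (n + 1 - k) * ‖ℓ (hermitePoly t k)‖ ^ 2 := by
    rw [Finset.sum_range_succ, charpolyMoment, adjugateMoment, ← Finset.sum_add_distrib]
    simp only [Nat.cast_add, Nat.cast_one, sub_self, mul_zero, zero_mul, add_zero]
    exact Finset.sum_congr rfl fun k _ => by ring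
  rw [raised, rest, ← Finset.sum_add_distrib, charpolyMoment]
  refine Finset.sum_congr rfl fun k _ => ?_
  rw [Nat.factorial_succ]
  push_cast
  ring

theorem IsElliptic.integral_norm_sq_map_charpoly_and_adjugate [IsProbabilityMeasure P]
    {A : Ω → Matrix (Fin n) (Fin n) ℂ} (hA : IsElliptic t A P) (ℓ : ℂ[X] →ₗ[ℂ] ℂ) :
    ∫ ω, ‖ℓ (A ω).charpoly‖ ^ 2 ∂P = charpolyMoment t ℓ n ∧
      ∑ i, ∑ j, ∫ ω, ‖ℓ ((A ω).charmatrix.adjugate i j)‖ ^ 2 ∂P = adjugateMoment t ℓ n := by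
  induction n generalizing ℓ with
  | zero => simp [charpolyMoment, adjugateMoment, hermitePoly]
  | succ n ih =>
    have ih' := fun j => ih (hA.deleteIndex j)
    constructor
    · rw [hA.integral_norm_sq_map_charpoly_succ ℓ 0, (ih' 0 ℓ).1, (ih' 0 ℓ).2, charpolyMoment_succ]
      exact congrArg (· + _) (ih' 0 (ℓ ∘ₗ raiseOp t)).1
    · have column : ∀ j, ∑ i, ∫ ω, ‖ℓ ((A ω).charmatrix.adjugate i j)‖ ^ 2 ∂P =
          charpolyMoment t ℓ n + adjugateMoment t ℓ n := fun j => by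
        simp only [Fin.sum_univ_succAbove _ j, adjugate_charmatrix_self, (ih' j ℓ).1,
          hA.integral_norm_sq_map_adjugate_succAbove, (ih' j ℓ).2]
      rw [Finset.sum_comm, adjugateMoment_succ]
      simp only [column, Finset.sum_const, Finset.card_univ, Fintype.card_fin, nsmul_eq_mul,
        Nat.cast_succ]

end Moments

end EllipticGinibre

/-! ### Gaussian moments and the Gaussian model -/

namespace EllipticGinibre

open scoped ComplexConjugate

section HasMean

variable {Ω : Type*} {mΩ : MeasurableSpace Ω} {P : Measure Ω}

/-- The random variable `f` is integrable with expectation `e`. Carrying both facts along lets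
the moments of polynomial expressions be computed term by term. -/
def HasMean (f : Ω → ℂ) (e : ℂ) (P : Measure Ω) : Prop := Integrable f P ∧ ∫ ω, f ω ∂P = e

namespace HasMean

variable {f g : Ω → ℂ} {a b : ℂ}

theorem congr (hf : HasMean f a P) (hfg : ∀ ω, g ω = f ω) (hab : b = a) : HasMean g b P := by
  rwa [funext hfg, hab]

theorem add (hf : HasMean f a P) (hg : HasMean g b P) :
    HasMean (fun ω => f ω + g ω) (a + b) P :=
  ⟨hf.1.add hg.1, by rw [integral_add hf.1 hg.1, hf.2, hg.2]⟩

theorem sum {ι : Type*} {s : Finset ι} {f : ι → Ω → ℂ} {a : ι → ℂ}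
    (h : ∀ i ∈ s, HasMean (f i) (a i) P) : HasMean (fun ω => ∑ i ∈ s, f i ω) (∑ i ∈ s, a i) P :=
  ⟨integrable_finsetSum s fun i hi => (h i hi).1, by
    rw [integral_finsetSum s fun i hi => (h i hi).1, Finset.sum_congr rfl fun i hi => (h i hi).2]⟩

theorem const_mul (c : ℂ) (hf : HasMean f a P) : HasMean (fun ω => c * f ω) (c * a) P :=
  ⟨hf.1.const_mul c, by rw [integral_const_mul, hf.2]⟩

theorem mul_of_indepFun (hf : HasMean f a P) (hg : HasMean g b P) (h : IndepFun f g P) :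
    HasMean (fun ω => f ω * g ω) (a * b) P :=
  ⟨h.integrable_mul hf.1 hg.1, by
    rw [h.integral_fun_mul_eq_mul_integral hf.1.1 hg.1.1, hf.2, hg.2]⟩

end HasMean

theorem HasMean.conj {f : Ω → ℂ} {a : ℂ} (hf : HasMean f a P) :
    HasMean (fun ω => conj (f ω)) (conj a) P :=
  ⟨memLp_one_iff_integrable.1 (memLp_one_iff_integrable.2 hf.1).star, by
    rw [integral_conj, hf.2]⟩

end HasMean

section GaussianMoments

/-- The moments of the standard real Gaussian. -/
def gaussianMoment (k : ℕ) : ℝ := ∫ x, x ^ k ∂gaussianReal 0 1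

theorem integrable_pow_gaussianReal (k : ℕ) : Integrable (fun x => x ^ k) (gaussianReal 0 1) :=
  ((memLp_id_gaussianReal (μ := 0) (v := 1) (k : NNReal)).integrable_norm_pow' (p := k)).mono'
    (by fun_prop) (ae_of_all _ fun x => by simp)

theorem hasDerivAt_gaussianPDFReal (x : ℝ) :
    HasDerivAt (gaussianPDFReal 0 1) (-(x * gaussianPDFReal 0 1 x)) x := by
  have h : HasDerivAt (fun x : ℝ => -x ^ 2 / 2) (-x) x := by
    simpa [neg_div] using ((hasDerivAt_pow 2 x).neg).div_const 2
  simp only [gaussianPDFReal_def, sub_zero, NNReal.coe_one, mul_one]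
  exact (h.exp.const_mul _).congr_deriv (by ring)

theorem integrable_pow_mul_gaussianPDFReal (k : ℕ) :
    Integrable fun x => x ^ k * gaussianPDFReal 0 1 x := by
  have h := integrable_pow_gaussianReal k
  rw [gaussianReal_of_var_ne_zero 0 one_ne_zero, integrable_withDensity_iff_integrable_smul'
    (measurable_gaussianPDF 0 1) (by simp [gaussianPDF])] at h
  simpa [toReal_gaussianPDF, mul_comm] using h

theorem gaussianMoment_eq_integral (k : ℕ) :
    gaussianMoment k = ∫ x, x ^ k * gaussianPDFReal 0 1 x := by
  simp only [gaussianMoment, integral_gaussianReal_eq_integral_smul one_ne_zero, smul_eq_mul,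
    mul_comm]

theorem gaussianMoment_add_two (k : ℕ) :
    gaussianMoment (k + 2) = (k + 1) * gaussianMoment k := by
  have hu : ∀ x : ℝ, HasDerivAt (fun x : ℝ => x ^ (k + 1)) ((k + 1) * x ^ k) x := fun x => by
    simpa using hasDerivAt_pow (k + 1) x
  have hparts := integral_mul_deriv_eq_deriv_mul_of_integrable (fun x _ => hu x)
    (fun x _ => hasDerivAt_gaussianPDFReal x)
    ((integrable_pow_mul_gaussianPDFReal (k + 2)).neg.congr (ae_of_all _ fun x => by
      simp only [Pi.neg_apply, Pi.mul_apply]; ring))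
    (((integrable_pow_mul_gaussianPDFReal k).const_mul (k + 1)).congr (ae_of_all _ fun x => by
      simp only [Pi.mul_apply]; ring))
    (integrable_pow_mul_gaussianPDFReal (k + 1))
  calc gaussianMoment (k + 2)
      = -∫ x, x ^ (k + 1) * -(x * gaussianPDFReal 0 1 x) := by
        rw [gaussianMoment_eq_integral, ← integral_neg]
        exact integral_congr_ae (ae_of_all _ fun x => by ring)
    _ = (k + 1) * gaussianMoment k := by
        simp only [hparts, neg_neg, mul_assoc, integral_const_mul, gaussianMoment_eq_integral]

@[simp] theorem gaussianMoment_zero : gaussianMoment 0 = 1 := by simp [gaussianMoment]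

@[simp] theorem gaussianMoment_one : gaussianMoment 1 = 0 := by simp [gaussianMoment]

@[simp] theorem gaussianMoment_two : gaussianMoment 2 = 1 := by simp [gaussianMoment_add_two 0]

@[simp] theorem gaussianMoment_three : gaussianMoment 3 = 0 := by simp [gaussianMoment_add_two 1]

@[simp] theorem gaussianMoment_four : gaussianMoment 4 = 3 := by
  norm_num [gaussianMoment_add_two 2]

variable {Ω : Type*} {mΩ : MeasurableSpace Ω} {P : Measure Ω}

theorem hasMean_pow_of_hasLaw {x : Ω → ℝ} (hx : HasLaw x (gaussianReal 0 1) P) (k : ℕ) :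
    HasMean (fun ω => (x ω : ℂ) ^ k) (gaussianMoment k) P := by
  have hint : Integrable (fun ω => x ω ^ k) P := by
    have h := integrable_pow_gaussianReal k
    rw [← hx.map_eq] at h
    exact h.comp_aemeasurable hx.aemeasurable
  have hval : ∫ ω, x ω ^ k ∂P = gaussianMoment k :=
    hx.integral_comp (f := fun r => r ^ k) (by fun_prop)
  exact ⟨by simpa using hint.ofReal (𝕜 := ℂ), by rw [← hval, ← integral_complex_ofReal]; simp⟩

end GaussianMoments

section CircularMoments

variable {Ω : Type*} {mΩ : MeasurableSpace Ω} {P : Measure Ω}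

/-- The random variable `ξ` has the mixed moments `𝔼[ξᵏ ξ̄ˡ] = δₖₗ k!` of the standard complex
Gaussian, for the exponents `k, l ≤ 2` that enter the covariance computations. -/
def HasCircularMoments (ξ : Ω → ℂ) (P : Measure Ω) : Prop :=
  ∀ k ≤ 2, ∀ l ≤ 2,
    HasMean (fun ω => ξ ω ^ k * conj (ξ ω) ^ l) (if k = l then (k.factorial : ℂ) else 0) P

theorem HasCircularMoments.conj {ξ : Ω → ℂ} (h : HasCircularMoments ξ P) :
    HasCircularMoments (fun ω => conj (ξ ω)) P := fun k hk l hl =>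
  (h l hl k hk).congr (fun ω => by rw [Complex.conj_conj, mul_comm]) (by
    rcases eq_or_ne k l with rfl | hkl
    · rfl
    · rw [if_neg hkl, if_neg hkl.symm])

theorem hasMean_add_mul_I_pow_mul_sub_mul_I_pow {x y : Ω → ℝ}
    (hx : HasLaw x (gaussianReal 0 1) P) (hy : HasLaw y (gaussianReal 0 1) P)
    (hxy : IndepFun x y P) (k l : ℕ) :
    HasMean (fun ω => (x ω + Complex.I * y ω) ^ k * (x ω - Complex.I * y ω) ^ l)
      (∑ p ∈ Finset.range (k + 1) ×ˢ Finset.range (l + 1),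
        Complex.I ^ (k - p.1) * (-Complex.I) ^ (l - p.2) * k.choose p.1 * l.choose p.2 *
          (gaussianMoment (p.1 + p.2) * gaussianMoment (k - p.1 + (l - p.2)))) P := by
  have hxy' : ∀ i j : ℕ, HasMean (fun ω => (x ω : ℂ) ^ i * (y ω : ℂ) ^ j)
      (gaussianMoment i * gaussianMoment j) P := fun i j =>
    (hasMean_pow_of_hasLaw hx i).mul_of_indepFun (hasMean_pow_of_hasLaw hy j)
      (hxy.comp (φ := fun r : ℝ => (r : ℂ) ^ i) (ψ := fun r : ℝ => (r : ℂ) ^ j)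
        (by fun_prop) (by fun_prop))
  refine (HasMean.sum fun p _ => (hxy' (p.1 + p.2) (k - p.1 + (l - p.2))).const_mul
    (Complex.I ^ (k - p.1) * (-Complex.I) ^ (l - p.2) * k.choose p.1 * l.choose p.2)).congr
      (fun ω => ?_) rfl
  rw [sub_eq_add_neg, ← neg_mul, add_pow, add_pow, Finset.sum_mul_sum, Finset.sum_product]
  refine Finset.sum_congr rfl fun i _ => Finset.sum_congr rfl fun j _ => ?_
  ring

theorem hasCircularMoments_of_hasLaw {x y : Ω → ℝ} (hx : HasLaw x (gaussianReal 0 1) P)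
    (hy : HasLaw y (gaussianReal 0 1) P) (hxy : IndepFun x y P) :
    HasCircularMoments (fun ω => (x ω + Complex.I * y ω) / (Real.sqrt 2 : ℂ)) P := by
  intro k hk l hl
  have hsqrt : ((Real.sqrt 2 : ℂ)⁻¹) ^ 2 = 1 / 2 := by
    norm_cast
    simp
  have hsqrt_four : ((Real.sqrt 2 : ℂ)⁻¹) ^ 4 = 1 / 4 := by
    rw [show 4 = 2 * 2 from rfl, pow_mul, hsqrt]
    norm_num
  refine ((hasMean_add_mul_I_pow_mul_sub_mul_I_pow hx hy hxy k l).const_mul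
    ((Real.sqrt 2 : ℂ)⁻¹ ^ (k + l))).congr (fun ω => ?_) ?_
  · simp only [div_eq_mul_inv, map_mul, map_add, map_inv₀, Complex.conj_ofReal, Complex.conj_I,
      neg_mul, ← sub_eq_add_neg, mul_pow, pow_add]
    ring
  · interval_cases k <;> interval_cases l <;>
      simp [Finset.sum_product, Finset.sum_range_succ, hsqrt, hsqrt_four] <;> norm_num

end CircularMoments

end EllipticGinibre

namespace EllipticGinibre

open scoped ComplexConjugate

section EllipticPair

variable {Ω : Type*} {mΩ : MeasurableSpace Ω} {P : Measure Ω} {ξ η : Ω → ℂ} {a b t : ℝ}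

theorem hasMean_elliptic (hξ : HasMean ξ 0 P) (hη : HasMean η 0 P) :
    HasMean (fun ω => a * ξ ω + Complex.I * b * η ω) 0 P :=
  ((hξ.const_mul a).add (hη.const_mul (Complex.I * b))).congr (fun _ => rfl) (by simp)

theorem hasMean_elliptic_mul_conj (hξ : HasMean ξ 0 P) (hη : HasMean η 0 P)
    (hξ₂ : HasMean (fun ω => ξ ω * conj (ξ ω)) 1 P) (hη₂ : HasMean (fun ω => η ω * conj (η ω)) 1 P)
    (hind : IndepFun ξ η P) :
    HasMean (fun ω => (a * ξ ω + Complex.I * b * η ω) * conj (a * ξ ω + Complex.I * b * η ω))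
      (a ^ 2 + b ^ 2) P := by
  have hcross : HasMean (fun ω => ξ ω * conj (η ω)) 0 P :=
    (hξ.mul_of_indepFun hη.conj (hind.comp measurable_id (measurable_conj measurable_id))).congr
      (fun _ => rfl) (by simp)
  refine (((hξ₂.const_mul (a ^ 2)).add (hη₂.const_mul (b ^ 2))).add
    ((hcross.const_mul (-(Complex.I * a * b))).add
      (hcross.conj.const_mul (Complex.I * a * b)))).congr (fun ω => ?_) (by simp)
  simp only [map_add, map_mul, Complex.conj_ofReal, Complex.conj_I, Complex.conj_conj]
  linear_combination (-(b : ℂ) ^ 2 * η ω * conj (η ω)) * Complex.I_sq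

theorem HasCircularMoments.mul_of_indepFun (hξ : HasCircularMoments ξ P)
    (hη : HasCircularMoments η P) (hind : IndepFun ξ η P) {k l m p : ℕ} (hk : k ≤ 2) (hl : l ≤ 2)
    (hm : m ≤ 2) (hp : p ≤ 2) :
    HasMean (fun ω => ξ ω ^ k * conj (ξ ω) ^ l * (η ω ^ m * conj (η ω) ^ p))
      ((if k = l then (k.factorial : ℂ) else 0) * (if m = p then (m.factorial : ℂ) else 0)) P :=
  (hξ k hk l hl).mul_of_indepFun (hη m hm p hp) (hind.comp
    (φ := fun z : ℂ => z ^ k * conj z ^ l) (ψ := fun z : ℂ => z ^ m * conj z ^ p)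
    ((measurable_id.pow_const k).mul ((measurable_conj measurable_id).pow_const l))
    ((measurable_id.pow_const m).mul ((measurable_conj measurable_id).pow_const p)))

theorem elliptic_mul_elliptic (a b : ℝ) (z w : ℂ) :
    (a * z + Complex.I * b * w) * (a * conj z + Complex.I * b * conj w) =
      a ^ 2 * (z * conj z) - b ^ 2 * (w * conj w) +
        Complex.I * a * b * (z * conj w + conj z * w) := by
  linear_combination (b ^ 2 * w * conj w : ℂ) * Complex.I_sq

theorem hasMean_elliptic_mul_conj_elliptic (hξ : HasCircularMoments ξ P)
    (hη : HasCircularMoments η P) :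
    HasMean (fun ω => (a * ξ ω + Complex.I * b * η ω) *
      conj (a * conj (ξ ω) + Complex.I * b * conj (η ω))) 0 P := by
  refine (((hξ 2 le_rfl 0 zero_le_two).const_mul (a ^ 2)).add
    ((hη 2 le_rfl 0 zero_le_two).const_mul (b ^ 2))).congr (fun ω => ?_) (by simp)
  simp only [map_add, map_mul, Complex.conj_ofReal, Complex.conj_I, Complex.conj_conj]
  linear_combination (-(b : ℂ) ^ 2 * η ω ^ 2) * Complex.I_sq

theorem hasMean_elliptic_mul_elliptic (hξ : HasCircularMoments ξ P)
    (hη : HasCircularMoments η P) (hind : IndepFun ξ η P) :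
    HasMean (fun ω => (a * ξ ω + Complex.I * b * η ω) *
      (a * conj (ξ ω) + Complex.I * b * conj (η ω))) (a ^ 2 - b ^ 2) P := by
  refine ((((hξ 1 one_le_two 1 one_le_two).const_mul (a ^ 2)).add
    ((hη 1 one_le_two 1 one_le_two).const_mul (-b ^ 2))).add
    (((hξ.mul_of_indepFun hη hind (k := 1) (l := 0) (m := 0) (p := 1)
        (by simp) (by simp) (by simp) (by simp)).const_mul (Complex.I * a * b)).add
      ((hξ.mul_of_indepFun hη hind (k := 0) (l := 1) (m := 1) (p := 0)
        (by simp) (by simp) (by simp) (by simp)).const_mul (Complex.I * a * b)))).congr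
    (fun ω => ?_) (by simp [sub_eq_add_neg])
  rw [elliptic_mul_elliptic]
  ring

theorem hasMean_elliptic_mul_elliptic_mul_conj (hξ : HasCircularMoments ξ P)
    (hη : HasCircularMoments η P) (hind : IndepFun ξ η P) :
    HasMean (fun ω => ((a * ξ ω + Complex.I * b * η ω) *
        (a * conj (ξ ω) + Complex.I * b * conj (η ω))) *
      conj ((a * ξ ω + Complex.I * b * η ω) * (a * conj (ξ ω) + Complex.I * b * conj (η ω))))
      (2 * a ^ 4 + 2 * b ^ 4) P := by
  refine ((((hξ 2 le_rfl 2 le_rfl).const_mul (a ^ 4)).add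
    ((hη 2 le_rfl 2 le_rfl).const_mul (b ^ 4))).add
    (((hξ.mul_of_indepFun hη hind (k := 2) (l := 0) (m := 0) (p := 2)
        (by simp) (by simp) (by simp) (by simp)).const_mul (a ^ 2 * b ^ 2)).add
      ((hξ.mul_of_indepFun hη hind (k := 0) (l := 2) (m := 2) (p := 0)
        (by simp) (by simp) (by simp) (by simp)).const_mul (a ^ 2 * b ^ 2)))).congr
    (fun ω => ?_) (by simp [mul_comm])
  simp only [elliptic_mul_elliptic, map_add, map_sub, map_mul, map_pow, Complex.conj_ofReal,
    Complex.conj_I, Complex.conj_conj]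
  linear_combination (-(a : ℂ) ^ 2 * b ^ 2 * (ξ ω * conj (η ω) + conj (ξ ω) * η ω) ^ 2) *
    Complex.I_sq

end EllipticPair

section Model

variable {Ω : Type*} {mΩ : MeasurableSpace Ω} {P : Measure Ω}

/-- A family of independent standard real Gaussian variables. -/
structure IsStdGaussianFamily {ι : Type*} (G : ι → Ω → ℝ) (P : Measure Ω) : Prop where
  measurable : ∀ i, Measurable (G i)
  hasLaw : ∀ i, HasLaw (G i) (gaussianReal 0 1) P
  iIndepFun : iIndepFun G P

theorem IsStdGaussianFamily.precomp {ι κ : Type*} {G : ι → Ω → ℝ} (hG : IsStdGaussianFamily G P)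
    {e : κ → ι} (he : Function.Injective e) : IsStdGaussianFamily (fun k => G (e k)) P :=
  ⟨fun _ => hG.measurable _, fun _ => hG.hasLaw _, hG.iIndepFun.precomp he⟩

theorem isStdGaussianFamily_eval (ι : Type*) [Fintype ι] :
    IsStdGaussianFamily (fun (i : ι) (ω : ι → ℝ) => ω i) (Measure.pi fun _ => gaussianReal 0 1) :=
  ⟨measurable_pi_apply, fun i => (measurePreserving_eval (fun _ : ι => gaussianReal 0 1) i).hasLaw,
    iIndepFun_pi (X := fun _ x => x) fun _ => aemeasurable_id⟩

variable {n : ℕ}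

theorem conj_hermitianOf (g : Fin n × Fin n → ℝ) (i j : Fin n) :
    conj (hermitianOf g i j) = hermitianOf g j i := by
  rcases lt_trichotomy i j with h | rfl | h
  · simp [hermitianOf, h.ne, h.ne', h, h.not_gt, sub_eq_add_neg]
  · simp [hermitianOf]
  · simp [hermitianOf, h.ne, h.ne', h, h.not_gt, sub_eq_add_neg]

theorem exists_hermitianOf_eq (i j : Fin n) :
    ∃ c d : ℂ, ∀ g : Fin n × Fin n → ℝ, hermitianOf g i j = c * g (i, j) + d * g (j, i) := by
  simp only [hermitianOf, Matrix.of_apply]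
  split_ifs with hij hlt
  · subst hij
    exact ⟨1, 0, fun g => by simp⟩
  · exact ⟨1 / (Real.sqrt 2 : ℂ), Complex.I / (Real.sqrt 2 : ℂ), fun g => by ring⟩
  · exact ⟨-Complex.I / (Real.sqrt 2 : ℂ), 1 / (Real.sqrt 2 : ℂ), fun g => by ring⟩

section GUE

variable {g : Fin n × Fin n → Ω → ℝ}

theorem hasCircularMoments_hermitianOf (hg : IsStdGaussianFamily g P) {i j : Fin n} (hij : i ≠ j) :
    HasCircularMoments (fun ω => hermitianOf (fun p => g p ω) i j) P := by
  have hupper : ∀ {i j : Fin n}, i < j →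
      HasCircularMoments (fun ω => hermitianOf (fun p => g p ω) i j) P := fun {i j} h => by
    simpa [hermitianOf, h, h.ne] using hasCircularMoments_of_hasLaw (hg.hasLaw (i, j))
      (hg.hasLaw (j, i)) (hg.iIndepFun.indepFun (by simp [h.ne]))
  rcases lt_or_gt_of_ne hij with h | h
  · exact hupper h
  · simpa only [conj_hermitianOf] using (hupper h).conj

theorem hasMean_hermitianOf (hg : IsStdGaussianFamily g P) (i j : Fin n) :
    HasMean (fun ω => hermitianOf (fun p => g p ω) i j) 0 P := by
  rcases eq_or_ne i j with rfl | hij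
  · exact (hasMean_pow_of_hasLaw (hg.hasLaw (i, i)) 1).congr (fun ω => by simp [hermitianOf])
      (by simp)
  · exact (hasCircularMoments_hermitianOf hg hij 1 one_le_two 0 zero_le_two).congr
      (fun ω => by simp) (by simp)

theorem hasMean_hermitianOf_mul_conj (hg : IsStdGaussianFamily g P) (i j : Fin n) :
    HasMean (fun ω => hermitianOf (fun p => g p ω) i j *
      conj (hermitianOf (fun p => g p ω) i j)) 1 P := by
  rcases eq_or_ne i j with rfl | hij
  · exact (hasMean_pow_of_hasLaw (hg.hasLaw (i, i)) 2).congr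
      (fun ω => by simp [hermitianOf, sq]) (by simp)
  · exact (hasCircularMoments_hermitianOf hg hij 1 one_le_two 1 one_le_two).congr
      (fun ω => by simp) (by simp)

end GUE

theorem ellipticMatrix_apply (t : ℝ) (X Y : Matrix (Fin n) (Fin n) ℂ) (i j : Fin n) :
    ellipticMatrix t X Y i j = (Real.sqrt ((1 + t) / 2) : ℂ) * X i j +
      Complex.I * (Real.sqrt ((1 - t) / 2) : ℂ) * Y i j := by
  simp [ellipticMatrix]

theorem exists_ellipticMatrix_hermitianOf_eq (t : ℝ) (i j : Fin n) : ∃ c d c' d' : ℂ,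
    ∀ g h : Fin n × Fin n → ℝ, ellipticMatrix t (hermitianOf g) (hermitianOf h) i j =
      c * g (i, j) + d * g (j, i) + (c' * h (i, j) + d' * h (j, i)) := by
  obtain ⟨c, d, hcd⟩ := exists_hermitianOf_eq i j
  refine ⟨Real.sqrt ((1 + t) / 2) * c, Real.sqrt ((1 + t) / 2) * d,
    Complex.I * Real.sqrt ((1 - t) / 2) * c, Complex.I * Real.sqrt ((1 - t) / 2) * d,
    fun g h => ?_⟩
  simp only [ellipticMatrix_apply, hcd]
  ring

section Elliptic

/-- The elliptic matrix built from a family `G` of real random variables, whose left and right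
halves generate the two Hermitian matrices. -/
def ellipticOf (t : ℝ) (G : (Fin n × Fin n) ⊕ (Fin n × Fin n) → Ω → ℝ) (ω : Ω) :
    Matrix (Fin n) (Fin n) ℂ :=
  ellipticMatrix t (hermitianOf fun p => G (.inl p) ω) (hermitianOf fun p => G (.inr p) ω)

variable {G : (Fin n × Fin n) ⊕ (Fin n × Fin n) → Ω → ℝ} {t : ℝ}

theorem ellipticOf_apply (i j : Fin n) (ω : Ω) :
    ellipticOf t G ω i j =
      (Real.sqrt ((1 + t) / 2) : ℂ) * hermitianOf (fun p => G (.inl p) ω) i j +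
        Complex.I * (Real.sqrt ((1 - t) / 2) : ℂ) * hermitianOf (fun p => G (.inr p) ω) i j :=
  ellipticMatrix_apply _ _ _ _ _

theorem ellipticOf_apply_swap (i j : Fin n) (ω : Ω) :
    ellipticOf t G ω j i =
      (Real.sqrt ((1 + t) / 2) : ℂ) * conj (hermitianOf (fun p => G (.inl p) ω) i j) +
        Complex.I * (Real.sqrt ((1 - t) / 2) : ℂ) *
          conj (hermitianOf (fun p => G (.inr p) ω) i j) := by
  simp only [conj_hermitianOf, ellipticOf_apply]

theorem measurable_ellipticOf_apply {m : MeasurableSpace Ω} {i j : Fin n}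
    (h : ∀ q, Sum.elim (fun p : Fin n × Fin n => s(p.1, p.2)) (fun p => s(p.1, p.2)) q = s(i, j) →
      Measurable[m] (G q)) : Measurable[m] fun ω => ellipticOf t G ω i j := by
  obtain ⟨c, d, c', d', hlin⟩ := exists_ellipticMatrix_hermitianOf_eq t i j
  simp only [ellipticOf, hlin]
  have hx := h (.inl (i, j)) rfl
  have hy := h (.inl (j, i)) Sym2.eq_swap
  have hu := h (.inr (i, j)) rfl
  have hv := h (.inr (j, i)) Sym2.eq_swap
  fun_prop

theorem indepFun_hermitianOf (hG : IsStdGaussianFamily G P) (i j : Fin n) :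
    IndepFun (fun ω => hermitianOf (fun p => G (.inl p) ω) i j)
      (fun ω => hermitianOf (fun p => G (.inr p) ω) i j) P := by
  obtain ⟨c, d, hcd⟩ := exists_hermitianOf_eq i j
  simp only [hcd]
  exact (hG.iIndepFun.indepFun_prodMk_prodMk hG.measurable (.inl (i, j)) (.inl (j, i))
    (.inr (i, j)) (.inr (j, i)) (by simp) (by simp) (by simp) (by simp)).comp
      (φ := fun z : ℝ × ℝ => c * (z.1 : ℂ) + d * z.2)
      (ψ := fun z : ℝ × ℝ => c * (z.1 : ℂ) + d * z.2) (by fun_prop) (by fun_prop)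

theorem indep_blockSigma_ellipticOf (hG : IsStdGaussianFamily G P) {S T : Set (Sym2 (Fin n))}
    (hST : Disjoint S T) :
    Indep (blockSigma (ellipticOf t G) S) (blockSigma (ellipticOf t G) T) P := by
  let block : (Fin n × Fin n) ⊕ (Fin n × Fin n) → Sym2 (Fin n) :=
    Sum.elim (fun p => s(p.1, p.2)) fun p => s(p.1, p.2)
  have hle : ∀ S : Set (Sym2 (Fin n)), blockSigma (ellipticOf t G) S ≤
      ⨆ q ∈ block ⁻¹' S, MeasurableSpace.comap (G q) inferInstance := fun S =>
    blockSigma_le fun i j hij => measurable_ellipticOf_apply fun q hq => by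
      rw [measurable_iff_comap_le]
      exact le_iSup₂_of_le (f := fun q (_ : q ∈ block ⁻¹' S) =>
        MeasurableSpace.comap (G q) inferInstance) q (by simpa [block, hq] using hij) le_rfl
  exact indep_of_indep_of_le_left (indep_of_indep_of_le_right
    (indep_iSup_of_disjoint (fun q => (hG.measurable q).comap_le) hG.iIndepFun.iIndep
      (hST.preimage block)) (hle T)) (hle S)

theorem memLp_four_ellipticOf_apply (hG : IsStdGaussianFamily G P) (i j : Fin n) :
    MemLp (fun ω => ellipticOf t G ω i j) 4 P := by
  have hmem : ∀ q, MemLp (fun ω => (G q ω : ℂ)) 4 P := fun q =>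
    ((memLp_id_gaussianReal' 4 (by norm_num)).comp_measurePreserving
      ((hG.hasLaw q).measurePreserving (hG.measurable q))).ofReal
  obtain ⟨c, d, c', d', hlin⟩ := exists_ellipticMatrix_hermitianOf_eq t i j
  simp only [ellipticOf, hlin]
  exact (((hmem _).const_mul c).add ((hmem _).const_mul d)).add
    (((hmem _).const_mul c').add ((hmem _).const_mul d'))

theorem isElliptic_ellipticOf (hG : IsStdGaussianFamily G P) (ht : t ∈ Set.Icc (-1 : ℝ) 1) :
    IsElliptic t (ellipticOf t G) P := by
  have ha : (Real.sqrt ((1 + t) / 2) : ℂ) ^ 2 = (1 + t) / 2 := by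
    exact_mod_cast Real.sq_sqrt (by linarith [ht.1] : 0 ≤ (1 + t) / 2)
  have hb : (Real.sqrt ((1 - t) / 2) : ℂ) ^ 2 = (1 - t) / 2 := by
    exact_mod_cast Real.sq_sqrt (by linarith [ht.2] : 0 ≤ (1 - t) / 2)
  have hX : IsStdGaussianFamily (fun p => G (.inl p)) P := hG.precomp Sum.inl_injective
  have hY : IsStdGaussianFamily (fun p => G (.inr p)) P := hG.precomp Sum.inr_injective
  have hXc := fun i j => hasCircularMoments_hermitianOf hX (i := i) (j := j)
  have hYc := fun i j => hasCircularMoments_hermitianOf hY (i := i) (j := j)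
  exact {
    measurable i j := measurable_ellipticOf_apply fun q _ => hG.measurable q
    indep S T hST := indep_blockSigma_ellipticOf hG hST
    memLp := memLp_four_ellipticOf_apply hG
    mean i j := by
      simp only [ellipticOf_apply]
      exact (hasMean_elliptic (hasMean_hermitianOf hX i j) (hasMean_hermitianOf hY i j)).2
    sq i j := by
      simp only [ellipticOf_apply]
      refine (hasMean_elliptic_mul_conj (hasMean_hermitianOf hX i j) (hasMean_hermitianOf hY i j)
        (hasMean_hermitianOf_mul_conj hX i j) (hasMean_hermitianOf_mul_conj hY i j)
        (indepFun_hermitianOf hG i j)).2.trans ?_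
      rw [ha, hb]
      ring
    cross_conj i j hij := by
      simp only [ellipticOf_apply i j, ellipticOf_apply_swap i j]
      exact (hasMean_elliptic_mul_conj_elliptic (hXc i j hij) (hYc i j hij)).2
    cross i j hij := by
      simp only [ellipticOf_apply i j, ellipticOf_apply_swap i j]
      refine (hasMean_elliptic_mul_elliptic (hXc i j hij) (hYc i j hij)
        (indepFun_hermitianOf hG i j)).2.trans ?_
      rw [ha, hb]
      ring
    fourth i j hij := by
      simp only [ellipticOf_apply i j, ellipticOf_apply_swap i j]
      refine (hasMean_elliptic_mul_elliptic_mul_conj (hXc i j hij) (hYc i j hij)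
        (indepFun_hermitianOf hG i j)).2.trans ?_
      linear_combination 2 * ((Real.sqrt ((1 + t) / 2) : ℂ) ^ 2 + (1 + t) / 2) * ha +
        2 * ((Real.sqrt ((1 - t) / 2) : ℂ) ^ 2 + (1 - t) / 2) * hb }

end Elliptic

end Model

end EllipticGinibre

/-! ### Hermite polynomials at the saddle point -/

namespace EllipticGinibre

open Polynomial
open scoped Nat Real

section Hermite

theorem norm_iteratedDeriv_le_circleAverage {E : Type*} [NormedAddCommGroup E] [NormedSpace ℂ E]
    [CompleteSpace E] {f : ℂ → E} {c : ℂ} {R : ℝ} (hR : 0 < R) (k : ℕ)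
    (hf : DiffContOnCl ℂ f (Metric.ball c R)) :
    ‖iteratedDeriv k f c‖ ≤ k ! / R ^ k * Real.circleAverage (fun z => ‖f z‖) c R := by
  have cauchy : ‖(2 * π * Complex.I / k ! : ℂ) • iteratedDeriv k f c‖ ≤
      (R ^ k)⁻¹ * ∫ θ in (0 : ℝ)..2 * π, ‖f (circleMap c R θ)‖ := by
    rw [← hf.circleIntegral_one_div_sub_center_pow_smul hR k, ← intervalIntegral.integral_const_mul]
    refine (intervalIntegral.norm_integral_le_integral_norm Real.two_pi_pos.le).trans_eq ?_
    refine intervalIntegral.integral_congr fun θ _ => ?_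
    simp only [norm_smul, deriv_circleMap, norm_mul, norm_circleMap_zero, Complex.norm_I, mul_one,
      circleMap_sub_center, norm_div, norm_one, norm_pow, abs_of_pos hR]
    field_simp
    ring
  have norm_factor : ‖(2 * π * Complex.I / k ! : ℂ)‖ = 2 * π / k ! := by
    simp [abs_of_pos Real.pi_pos]
  rw [norm_smul, norm_factor, ← le_div_iff₀' (by positivity)] at cauchy
  refine cauchy.trans_eq ?_
  rw [Real.circleAverage_def, smul_eq_mul]
  field_simp

/-- The exponential generating function `v ↦ exp(x v - t v² / 2)` of the Hermite polynomials of
variance `t` at the point `x`. -/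
def hermiteGen (t : ℝ) (x v : ℂ) : ℂ := Complex.exp (x * v - t * v ^ 2 / 2)

theorem differentiable_hermiteGen (t : ℝ) (x : ℂ) : Differentiable ℂ (hermiteGen t x) := by
  unfold hermiteGen
  fun_prop

theorem hasDerivAt_hermiteGen (t : ℝ) (x v : ℂ) :
    HasDerivAt (hermiteGen t x) ((x - t * v) * hermiteGen t x v) v := by
  have h := (((hasDerivAt_id' v).const_mul x).sub
    ((((hasDerivAt_id' v).pow 2).const_mul (t : ℂ)).div_const 2)).cexp
  refine h.congr_deriv ?_
  simp only [hermiteGen, Pi.sub_apply, Pi.pow_apply]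
  ring

theorem iteratedDeriv_hermiteGen (t : ℝ) (x : ℂ) (k : ℕ) :
    iteratedDeriv k (hermiteGen t x) = fun v =>
      (hermitePoly t k).eval (x - t * v) * hermiteGen t x v := by
  induction k with
  | zero => ext v; simp [hermitePoly]
  | succ k ih =>
    ext v
    have shift : HasDerivAt (fun v => x - t * v) (-t) v := by
      simpa using ((hasDerivAt_id' v).const_mul (t : ℂ)).const_sub x
    have h := (((hermitePoly t k).hasDerivAt (x - t * v)).comp v shift).mul
      (hasDerivAt_hermiteGen t x v)
    rw [iteratedDeriv_succ, ih]
    refine h.deriv.trans ?_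
    simp only [hermitePoly, raiseOp_apply, eval_sub, eval_mul, eval_X, eval_C, Function.comp]
    ring

theorem norm_eval_hermitePoly_le_circleAverage (t : ℝ) (x m : ℂ) (k : ℕ) {ρ : ℝ} (hρ : 0 < ρ) :
    ‖m‖ ^ k * ‖(hermitePoly t k).eval x‖ ≤
      k ! / ρ ^ k * Real.circleAverage (fun u => ‖hermiteGen t x (m * u)‖) 0 ρ := by
  have scaled : Differentiable ℂ fun u => hermiteGen t x (m * u) :=
    (differentiable_hermiteGen t x).comp (differentiable_id.const_mul m)
  have derivative_zero : iteratedDeriv k (fun u => hermiteGen t x (m * u)) 0 =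
      m ^ k * (hermitePoly t k).eval x := by
    rw [iteratedDeriv_comp_const_mul (differentiable_hermiteGen t x).contDiff,
      iteratedDeriv_hermiteGen]
    simp [hermiteGen]
  simpa only [derivative_zero, norm_mul, norm_pow] using
    norm_iteratedDeriv_le_circleAverage hρ k (scaled.diffContOnCl (s := Metric.ball 0 ρ))

end Hermite

section CircleAverage

theorem integral_exp_neg_mul_one_sub_cos_le {c : ℝ} (hc : 0 < c) :
    ∫ θ in (-π)..π, Real.exp (-(c * (1 - Real.cos θ))) ≤ Real.sqrt (π ^ 3 / (2 * c)) := by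
  have hπ := Real.pi_pos
  have pointwise : ∀ θ ∈ Set.Icc (-π) π,
      Real.exp (-(c * (1 - Real.cos θ))) ≤ Real.exp (-(2 * c / π ^ 2) * θ ^ 2) := by
    intro θ hθ
    have jordan := Real.cos_le_one_sub_mul_cos_sq (abs_le.2 hθ)
    have scaled : c * (2 / π ^ 2 * θ ^ 2) ≤ c * (1 - Real.cos θ) := by gcongr; linarith
    rw [Real.exp_le_exp]
    calc -(c * (1 - Real.cos θ)) ≤ -(c * (2 / π ^ 2 * θ ^ 2)) := neg_le_neg scaled
      _ = -(2 * c / π ^ 2) * θ ^ 2 := by ring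
  calc ∫ θ in (-π)..π, Real.exp (-(c * (1 - Real.cos θ)))
      ≤ ∫ θ in (-π)..π, Real.exp (-(2 * c / π ^ 2) * θ ^ 2) :=
        intervalIntegral.integral_mono_on (by linarith)
          (Continuous.intervalIntegrable (by fun_prop) _ _)
          (Continuous.intervalIntegrable (by fun_prop) _ _) pointwise
    _ ≤ ∫ θ : ℝ, Real.exp (-(2 * c / π ^ 2) * θ ^ 2) := by
        rw [intervalIntegral.integral_of_le (by linarith)]
        exact setIntegral_le_integral (integrable_exp_neg_mul_sq (by positivity))
          (ae_of_all _ fun θ => (Real.exp_pos _).le)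
    _ = Real.sqrt (π ^ 3 / (2 * c)) := by
        rw [integral_gaussian]
        congr 1
        field_simp

theorem mul_one_sub_cos_le_norm_circleMap_sub_one_sq (ρ θ : ℝ) :
    2 * ρ * (1 - Real.cos θ) ≤ ‖circleMap 0 ρ θ - 1‖ ^ 2 := by
  rw [Complex.sq_norm, Complex.normSq_apply]
  simp only [circleMap_zero, Complex.sub_re, Complex.sub_im, Complex.re_ofReal_mul,
    Complex.im_ofReal_mul, Complex.exp_ofReal_mul_I_re, Complex.exp_ofReal_mul_I_im,
    Complex.one_re, Complex.one_im]
  linear_combination sq_nonneg (ρ - 1) - ρ ^ 2 * Real.sin_sq_add_cos_sq θ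

theorem circleAverage_exp_neg_norm_sub_one_sq_le {b ρ : ℝ} (hb : 0 < b) (hρ : 0 < ρ) :
    Real.circleAverage (fun u => Real.exp (-(b * ‖u - 1‖ ^ 2 / 2))) 0 ρ ≤
      (Real.sqrt (b * ρ))⁻¹ := by
  have hπ := Real.pi_pos
  have pointwise (θ : ℝ) : Real.exp (-(b * ‖circleMap 0 ρ θ - 1‖ ^ 2 / 2)) ≤
      Real.exp (-(b * ρ * (1 - Real.cos θ))) := by
    rw [Real.exp_le_exp]
    linarith [mul_le_mul_of_nonneg_left (mul_one_sub_cos_le_norm_circleMap_sub_one_sq ρ θ) hb.le]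
  have shift : Real.circleAverage (fun u => Real.exp (-(b * ‖u - 1‖ ^ 2 / 2))) 0 ρ =
      (2 * π)⁻¹ * ∫ θ in (-π)..π, Real.exp (-(b * ‖circleMap 0 ρ θ - 1‖ ^ 2 / 2)) := by
    have periodic := ((periodic_circleMap 0 ρ).comp fun u =>
      Real.exp (-(b * ‖u - 1‖ ^ 2 / 2))).intervalIntegral_add_eq 0 (-π)
    rw [zero_add, show -π + 2 * π = π by ring] at periodic
    exact congrArg ((2 * π)⁻¹ * ·) periodic
  rw [shift]
  calc (2 * π)⁻¹ * ∫ θ in (-π)..π, Real.exp (-(b * ‖circleMap 0 ρ θ - 1‖ ^ 2 / 2))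
      ≤ (2 * π)⁻¹ * ∫ θ in (-π)..π, Real.exp (-(b * ρ * (1 - Real.cos θ))) := by
        gcongr
        exact intervalIntegral.integral_mono_on (by linarith)
          (Continuous.intervalIntegrable (by fun_prop) _ _)
          (Continuous.intervalIntegrable (by fun_prop) _ _) fun θ _ => pointwise θ
    _ ≤ (2 * π)⁻¹ * Real.sqrt (π ^ 3 / (2 * (b * ρ))) := by
        gcongr
        exact integral_exp_neg_mul_one_sub_cos_le (by positivity)
    _ = Real.sqrt (π / 8 * (b * ρ)⁻¹) := by
        rw [← Real.sqrt_sq (show 0 ≤ (2 * π)⁻¹ by positivity), ← Real.sqrt_mul (by positivity)]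
        congr 1
        field_simp
        ring
    _ ≤ Real.sqrt (1 * (b * ρ)⁻¹) := by
        gcongr
        linarith [Real.pi_le_four]
    _ = (Real.sqrt (b * ρ))⁻¹ := by rw [one_mul, Real.sqrt_inv]

end CircleAverage

section HermiteBound

-- Since `(1 + w) u - w u² / 2 = u + w / 2 - w (u - 1)² / 2`, the point `u = 1` is a saddle.
theorem re_saddle_le (w u : ℂ) :
    ((1 + w) * u - w * u ^ 2 / 2).re ≤
      (1 + ‖u‖ ^ 2 + w.re) / 2 - (1 - ‖w‖) * ‖u - 1‖ ^ 2 / 2 := by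
  have expand : ((1 + w) * u - w * u ^ 2 / 2).re =
      u.re + w.re / 2 - (w * (u - 1) ^ 2).re / 2 := by
    have half (v : ℂ) : (v / 2).re = v.re / 2 := Complex.div_ofNat_re v 2
    rw [← half, ← half, ← Complex.add_re, ← Complex.sub_re]
    congr 1
    ring
  have polarization : ‖u - 1‖ ^ 2 = 1 + ‖u‖ ^ 2 - 2 * u.re := by
    simp only [Complex.sq_norm, Complex.normSq_apply, Complex.sub_re, Complex.sub_im,
      Complex.one_re, Complex.one_im]
    ring
  have lower : -(‖w‖ * ‖u - 1‖ ^ 2) ≤ (w * (u - 1) ^ 2).re := by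
    rw [← norm_pow, ← norm_mul]
    exact (abs_le.1 (Complex.abs_re_le_norm _)).1
  linarith

theorem circleAverage_norm_hermiteGen_le {t a ρ : ℝ} {x m w : ℂ} (ha : 0 < a) (hρ : 0 < ρ)
    (hm : t * m ^ 2 = a * w) (hx : x * m = a * (1 + w)) (hw : ‖w‖ < 1) :
    Real.circleAverage (fun u => ‖hermiteGen t x (m * u)‖) 0 ρ ≤
      Real.exp (a * (1 + ρ ^ 2 + w.re) / 2) / Real.sqrt (a * (1 - ‖w‖) * ρ) := by
  have hb : 0 < a * (1 - ‖w‖) := mul_pos ha (sub_pos.2 hw)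
  have pointwise : ∀ u ∈ Metric.sphere (0 : ℂ) |ρ|, ‖hermiteGen t x (m * u)‖ ≤
      Real.exp (a * (1 + ρ ^ 2 + w.re) / 2) *
        Real.exp (-(a * (1 - ‖w‖) * ‖u - 1‖ ^ 2 / 2)) := by
    intro u hu
    have hu' : ‖u‖ = ρ := by rwa [mem_sphere_zero_iff_norm, abs_of_pos hρ] at hu
    have exponent : x * (m * u) - t * (m * u) ^ 2 / 2 = a * ((1 + w) * u - w * u ^ 2 / 2) := by
      linear_combination u * hx - u ^ 2 / 2 * hm
    rw [hermiteGen, Complex.norm_exp, exponent, Complex.re_ofReal_mul, ← Real.exp_add,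
      Real.exp_le_exp]
    have := mul_le_mul_of_nonneg_left (re_saddle_le w u) ha.le
    rw [hu'] at this
    linarith
  calc Real.circleAverage (fun u => ‖hermiteGen t x (m * u)‖) 0 ρ
      ≤ Real.circleAverage (fun u => Real.exp (a * (1 + ρ ^ 2 + w.re) / 2) *
          Real.exp (-(a * (1 - ‖w‖) * ‖u - 1‖ ^ 2 / 2))) 0 ρ :=
        Real.circleAverage_mono
          (((differentiable_hermiteGen t x).continuous.comp
            (continuous_const_mul m)).norm.continuousOn.circleIntegrable hρ.le)
          (Continuous.continuousOn (by fun_prop) |>.circleIntegrable hρ.le) pointwise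
    _ = Real.exp (a * (1 + ρ ^ 2 + w.re) / 2) *
          Real.circleAverage (fun u => Real.exp (-(a * (1 - ‖w‖) * ‖u - 1‖ ^ 2 / 2))) 0 ρ :=
        Real.circleAverage_fun_smul (𝕜 := ℝ)
    _ ≤ Real.exp (a * (1 + ρ ^ 2 + w.re) / 2) / Real.sqrt (a * (1 - ‖w‖) * ρ) := by
        rw [div_eq_mul_inv (Real.exp _)]
        gcongr
        exact circleAverage_exp_neg_norm_sub_one_sq_le hb hρ

theorem norm_sq_mul_eval_hermitePoly_sq_le {t a ρ : ℝ} {x m w : ℂ} (k : ℕ) (ha : 0 < a)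
    (hρ : 0 < ρ) (hm : t * m ^ 2 = a * w) (hx : x * m = a * (1 + w)) (hw : ‖w‖ < 1) :
    (‖m‖ ^ 2) ^ k * ‖(hermitePoly t k).eval x‖ ^ 2 ≤
      (k ! : ℝ) ^ 2 / (ρ ^ 2) ^ k *
        (Real.exp (a * (1 + ρ ^ 2 + w.re)) / (a * (1 - ‖w‖) * ρ)) := by
  have : 0 < 1 - ‖w‖ := sub_pos.2 hw
  have exp_sq : Real.exp (a * (1 + ρ ^ 2 + w.re) / 2) ^ 2 = Real.exp (a * (1 + ρ ^ 2 + w.re)) := by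
    rw [← Real.exp_nat_mul]
    congr 1
    push_cast
    ring
  have bound := (norm_eval_hermitePoly_le_circleAverage t x m k hρ).trans <|
    mul_le_mul_of_nonneg_left (circleAverage_norm_hermiteGen_le ha hρ hm hx hw) (by positivity)
  calc (‖m‖ ^ 2) ^ k * ‖(hermitePoly t k).eval x‖ ^ 2
      = (‖m‖ ^ k * ‖(hermitePoly t k).eval x‖) ^ 2 := by ring
    _ ≤ (k ! / ρ ^ k * (Real.exp (a * (1 + ρ ^ 2 + w.re) / 2) /
          Real.sqrt (a * (1 - ‖w‖) * ρ))) ^ 2 := by gcongr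
    _ = _ := by
        rw [mul_pow, div_pow, div_pow, exp_sq, Real.sq_sqrt (by positivity), pow_right_comm]

theorem norm_eval_hermitePoly_sq_le {n k : ℕ} (hn : n ≠ 0) (hk : k ≠ 0) {t : ℝ} {x z : ℂ}
    (hx : x * (Real.sqrt n * z) = n * (1 + t * z ^ 2)) (hw : ‖t * z ^ 2‖ < 1) :
    (‖z‖ ^ 2) ^ k * ‖(hermitePoly t k).eval x‖ ^ 2 ≤
      (k ! : ℝ) ^ 2 / (k : ℝ) ^ k * (Real.exp n * Real.exp k * Real.exp (n * (t * z ^ 2 : ℂ).re)) /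
        (Real.sqrt n * Real.sqrt k * (1 - ‖t * z ^ 2‖)) := by
  set w : ℂ := t * z ^ 2
  have hn0 : (0 : ℝ) < n := by positivity
  have hk0 : (0 : ℝ) < k := by positivity
  have sqrt_n : Real.sqrt n ^ 2 = n := Real.sq_sqrt hn0.le
  have hm : (t : ℂ) * (Real.sqrt n * z) ^ 2 = (n : ℝ) * w := by
    rw [mul_pow, ← Complex.ofReal_pow, sqrt_n]
    ring
  -- The radius `√(k / n)` minimises `exp (n ρ ^ 2 / 2) / ρ ^ k`.
  have bound := norm_sq_mul_eval_hermitePoly_sq_le k hn0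
    (show 0 < Real.sqrt k / Real.sqrt n by positivity) hm (by simpa using hx) hw
  have norm_sq : ‖(Real.sqrt n * z : ℂ)‖ ^ 2 = n * ‖z‖ ^ 2 := by
    rw [norm_mul, Complex.norm_real, mul_pow, Real.norm_eq_abs, sq_abs, sqrt_n]
  have radius_sq : (Real.sqrt k / Real.sqrt n) ^ 2 = k / n := by
    rw [div_pow, sqrt_n, Real.sq_sqrt hk0.le]
  have exponent : Real.exp (n * (1 + k / n + w.re)) =
      Real.exp n * Real.exp k * Real.exp (n * w.re) := by
    rw [← Real.exp_add, ← Real.exp_add]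
    congr 1
    field_simp
  have denominator : n * (1 - ‖w‖) * (Real.sqrt k / Real.sqrt n) =
      Real.sqrt n * Real.sqrt k * (1 - ‖w‖) := by
    nth_rewrite 1 [← sqrt_n]
    field_simp
  rw [norm_sq, radius_sq, exponent, denominator, mul_pow, div_pow] at bound
  refine le_of_mul_le_mul_left ?_ (pow_pos hn0 k)
  calc (n : ℝ) ^ k * ((‖z‖ ^ 2) ^ k * ‖(hermitePoly t k).eval x‖ ^ 2)
      ≤ _ := (mul_assoc _ _ _).ge.trans bound
    _ = _ := by field_simp

theorem factorial_mul_exp_div_le (m : ℕ) :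
    m ! * Real.exp m / (Real.sqrt m * (m : ℝ) ^ m) ≤ Real.exp 1 := by
  rcases m with _ | k
  · simpa using (Real.exp_pos 1).le
  have antitone : Stirling.stirlingSeq (k + 1) ≤ Stirling.stirlingSeq 1 :=
    Stirling.stirlingSeq'_antitone (Nat.zero_le k)
  have ratio : Stirling.stirlingSeq (k + 1) = (k + 1)! * Real.exp (k + 1 : ℕ) /
      (Real.sqrt (k + 1 : ℕ) * ((k + 1 : ℕ) : ℝ) ^ (k + 1)) / Real.sqrt 2 := by
    rw [Stirling.stirlingSeq, Real.sqrt_mul zero_le_two, div_pow, ← Real.exp_nat_mul, mul_one]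
    field_simp
  rw [ratio, Stirling.stirlingSeq_one] at antitone
  exact (div_le_div_iff_of_pos_right (by positivity)).1 antitone

theorem hermite_term_le {n k : ℕ} (hk : k ≠ 0) (hkn : k ≤ n) {t : ℝ} {x z : ℂ}
    (hx : x * (Real.sqrt n * z) = n * (1 + t * z ^ 2)) (hw : ‖t * z ^ 2‖ < 1) :
    (‖z‖ ^ 2 / n) ^ n * Real.exp (-(n * (t * z ^ 2 : ℂ).re)) *
      ((n ! : ℝ) / k ! * ‖(hermitePoly t k).eval x‖ ^ 2) ≤
      Real.exp 1 ^ 2 / (1 - ‖t * z ^ 2‖) * (‖z‖ ^ 2) ^ (n - k) := by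
  have hn : n ≠ 0 := by lia
  have hermite := norm_eval_hermitePoly_sq_le hn hk hx hw
  set w : ℂ := t * z ^ 2
  have : 0 < 1 - ‖w‖ := sub_pos.2 hw
  rw [Real.exp_neg]
  calc (‖z‖ ^ 2 / n) ^ n * (Real.exp (n * w.re))⁻¹ *
        ((n ! : ℝ) / k ! * ‖(hermitePoly t k).eval x‖ ^ 2)
      = (‖z‖ ^ 2) ^ (n - k) * ((n ! : ℝ) / k !) / (n : ℝ) ^ n / Real.exp (n * w.re) *
          ((‖z‖ ^ 2) ^ k * ‖(hermitePoly t k).eval x‖ ^ 2) := by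
        rw [div_pow, ← pow_sub_mul_pow (‖z‖ ^ 2) hkn]
        field_simp
    _ ≤ (‖z‖ ^ 2) ^ (n - k) * ((n ! : ℝ) / k !) / (n : ℝ) ^ n / Real.exp (n * w.re) *
          ((k ! : ℝ) ^ 2 / (k : ℝ) ^ k * (Real.exp n * Real.exp k * Real.exp (n * w.re)) /
            (Real.sqrt n * Real.sqrt k * (1 - ‖w‖))) := by
        gcongr
    _ = (n ! * Real.exp n / (Real.sqrt n * (n : ℝ) ^ n)) *
          (k ! * Real.exp k / (Real.sqrt k * (k : ℝ) ^ k)) / (1 - ‖w‖) * (‖z‖ ^ 2) ^ (n - k) := by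
        field_simp
    _ ≤ Real.exp 1 * Real.exp 1 / (1 - ‖w‖) * (‖z‖ ^ 2) ^ (n - k) := by
        gcongr
        · exact factorial_mul_exp_div_le n
        · exact factorial_mul_exp_div_le k
    _ = _ := by rw [← sq (Real.exp 1)]

theorem hermite_term_zero_le {n : ℕ} (hn : n ≠ 0) {w z : ℂ} (hz : ‖z‖ ≤ 1) (hw : ‖w‖ < 1) :
    (‖z‖ ^ 2 / n) ^ n * Real.exp (-(n * w.re)) * n ! ≤ Real.exp 1 / (1 - ‖w‖) := by
  have : 0 < 1 - ‖w‖ := sub_pos.2 hw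
  have hn1 : (1 : ℝ) ≤ n := by exact_mod_cast Nat.one_le_iff_ne_zero.2 hn
  have exp_re : Real.exp (-(n * w.re)) ≤ Real.exp n * (n * (1 - ‖w‖))⁻¹ := by
    have re_le : -w.re ≤ ‖w‖ := (neg_le_abs _).trans (Complex.abs_re_le_norm w)
    calc Real.exp (-(n * w.re)) ≤ Real.exp (n - n * (1 - ‖w‖)) := by
          rw [Real.exp_le_exp]
          nlinarith
      _ = Real.exp n * (Real.exp (n * (1 - ‖w‖)))⁻¹ := Real.exp_sub _ _
      _ ≤ Real.exp n * (n * (1 - ‖w‖))⁻¹ := by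
          gcongr
          linarith [Real.add_one_le_exp (n * (1 - ‖w‖))]
  calc (‖z‖ ^ 2 / n) ^ n * Real.exp (-(n * w.re)) * n !
      ≤ (1 ^ 2 / n) ^ n * (Real.exp n * (n * (1 - ‖w‖))⁻¹) * n ! := by gcongr
    _ = n ! * Real.exp n / (Real.sqrt n * (n : ℝ) ^ n) * (Real.sqrt n / n) / (1 - ‖w‖) := by
        rw [one_pow, one_div, inv_pow]
        field_simp
    _ ≤ Real.exp 1 * 1 / (1 - ‖w‖) := by
        gcongr
        · exact factorial_mul_exp_div_le n
        · exact div_le_one_of_le₀ (Real.sqrt_le_self_iff.2 (.inr hn1)) (by positivity)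
    _ = _ := by rw [mul_one]

end HermiteBound

section SecondMoment

variable {n : ℕ} {t : ℝ} {z : ℂ}

/-- The bound, uniform in the size of the matrix, for the second moment of the normalised
characteristic polynomial at distance `r` from the origin. -/
def momentBound (r : ℝ) : ℝ :=
  (Real.exp 1 + Real.exp 1 ^ 2 / (1 - r ^ 2)) / (1 - r ^ 2)

theorem charpolyMoment_leval_le (hn : n ≠ 0) (ht : t ∈ Set.Icc (-1 : ℝ) 1) {x : ℂ} (hz : ‖z‖ < 1)
    (hx : x * (Real.sqrt n * z) = n * (1 + t * z ^ 2)) :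
    (‖z‖ ^ 2 / n) ^ n * Real.exp (-(n * (t * z ^ 2 : ℂ).re)) * charpolyMoment t (leval x) n ≤
      momentBound ‖z‖ := by
  have hz2 : ‖z‖ ^ 2 < 1 := pow_lt_one₀ (norm_nonneg z) hz two_ne_zero
  have norm_le : ‖(t : ℂ) * z ^ 2‖ ≤ ‖z‖ ^ 2 := by
    rw [norm_mul, norm_pow, Complex.norm_real]
    exact mul_le_of_le_one_left (by positivity) (abs_le.2 ht)
  have norm_lt := norm_le.trans_lt hz2
  have geometric : ∑ k ∈ Finset.range n, (‖z‖ ^ 2) ^ (n - (k + 1)) ≤ (1 - ‖z‖ ^ 2)⁻¹ := by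
    simp only [Nat.sub_add_eq, Nat.sub_right_comm n _ 1]
    rw [Finset.sum_range_reflect fun k => (‖z‖ ^ 2) ^ k,
      ← tsum_geometric_of_lt_one (by positivity) hz2]
    exact (summable_geometric_of_lt_one (by positivity) hz2).sum_le_tsum _
      fun i _ => by positivity
  have : 0 < 1 - ‖z‖ ^ 2 := sub_pos.2 hz2
  rw [charpolyMoment, Finset.mul_sum, Finset.sum_range_succ']
  simp only [leval_apply]
  calc _ ≤ ∑ k ∈ Finset.range n, Real.exp 1 ^ 2 / (1 - ‖(t : ℂ) * z ^ 2‖) *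
          (‖z‖ ^ 2) ^ (n - (k + 1)) + Real.exp 1 / (1 - ‖(t : ℂ) * z ^ 2‖) := by
        refine add_le_add (Finset.sum_le_sum fun k hk => ?_) ?_
        · exact hermite_term_le k.succ_ne_zero (Finset.mem_range.1 hk) hx norm_lt
        · simpa [hermitePoly] using hermite_term_zero_le hn hz.le norm_lt
    _ ≤ Real.exp 1 ^ 2 / (1 - ‖z‖ ^ 2) * (1 - ‖z‖ ^ 2)⁻¹ + Real.exp 1 / (1 - ‖z‖ ^ 2) := by
        rw [← Finset.mul_sum]
        gcongr
    _ = momentBound ‖z‖ := by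
        rw [momentBound]
        ring

theorem normCharFun_eq_eval_charpoly (hn : n ≠ 0) (t : ℝ) (A : Matrix (Fin n) (Fin n) ℂ)
    (hz : z ≠ 0) :
    normCharFun t A z = (z / Real.sqrt n) ^ n *
      A.charpoly.eval (Real.sqrt n * (1 + t * z ^ 2) / z) *
        Complex.exp (-((n : ℂ) * t * z ^ 2 / 2)) := by
  have sqrt_ne : (Real.sqrt n : ℂ) ≠ 0 := by
    have : Real.sqrt n ≠ 0 := by positivity
    exact_mod_cast this
  have factored : (1 + (t : ℂ) * z ^ 2) • (1 : Matrix (Fin n) (Fin n) ℂ) -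
      (z / (Real.sqrt n : ℂ)) • A = (z / (Real.sqrt n : ℂ)) •
        (Matrix.scalar (Fin n) (Real.sqrt n * (1 + t * z ^ 2) / z : ℂ) - A) := by
    rw [smul_sub, Matrix.scalar_apply, ← Matrix.smul_one_eq_diagonal, smul_smul]
    congr 2
    field_simp
  rw [normCharFun, factored, Matrix.det_smul, Fintype.card_fin, Matrix.eval_charpoly]

theorem norm_normCharFun_sq (hn : n ≠ 0) (t : ℝ) (A : Matrix (Fin n) (Fin n) ℂ) (hz : z ≠ 0) :
    ‖normCharFun t A z‖ ^ 2 =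
      (‖z‖ ^ 2 / n) ^ n * Real.exp (-(n * (t * z ^ 2 : ℂ).re)) *
        ‖leval (Real.sqrt n * (1 + t * z ^ 2) / z) A.charpoly‖ ^ 2 := by
  have norm_exp_sq : ‖Complex.exp (-((n : ℂ) * t * z ^ 2 / 2))‖ ^ 2 =
      Real.exp (-(n * (t * z ^ 2 : ℂ).re)) := by
    have exponent : -((n : ℂ) * t * z ^ 2 / 2) = ((-(n : ℝ) / 2 : ℝ) : ℂ) * (t * z ^ 2) := by
      push_cast
      ring
    rw [Complex.norm_exp, ← Real.exp_nat_mul, exponent, Complex.re_ofReal_mul]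
    congr 1
    push_cast
    ring
  rw [normCharFun_eq_eval_charpoly hn t A hz, norm_mul, norm_mul, mul_pow, mul_pow, norm_exp_sq,
    norm_pow, norm_div, Complex.norm_real, Real.norm_eq_abs, pow_right_comm, div_pow, sq_abs,
    Real.sq_sqrt n.cast_nonneg, leval_apply]
  ring

theorem IsElliptic.integral_norm_normCharFun_sq_le {Ω : Type*} {mΩ : MeasurableSpace Ω}
    {P : Measure Ω} [IsProbabilityMeasure P] {A : Ω → Matrix (Fin n) (Fin n) ℂ}
    (hA : IsElliptic t A P) (hn : n ≠ 0) (ht : t ∈ Set.Icc (-1 : ℝ) 1) (hz : z ≠ 0)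
    (hz1 : ‖z‖ < 1) :
    Integrable (fun ω => ‖normCharFun t (A ω) z‖ ^ 2) P ∧
      ∫ ω, ‖normCharFun t (A ω) z‖ ^ 2 ∂P ≤ momentBound ‖z‖ := by
  set x : ℂ := Real.sqrt n * (1 + t * z ^ 2) / z with x_def
  have hx : x * (Real.sqrt n * z) = n * (1 + t * z ^ 2) := by
    have sqrt_sq : (Real.sqrt n : ℂ) ^ 2 = n := by exact_mod_cast Real.sq_sqrt n.cast_nonneg
    rw [x_def, ← sqrt_sq]
    field_simp
  have memLp := (hA.memLp_map_charpoly_and_adjugate (leval x)).1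
  simp only [norm_normCharFun_sq hn t _ hz]
  refine ⟨((memLp_two_iff_integrable_sq_norm memLp.1).1 memLp).const_mul _, ?_⟩
  rw [integral_const_mul, (hA.integral_norm_sq_map_charpoly_and_adjugate (leval x)).1]
  exact charpolyMoment_leval_le hn ht hz1 hx

end SecondMoment
end EllipticGinibre

/-! ### Montel's theorem and tightness -/

namespace EllipticGinibre

open Filter Topology
open scoped ENNReal NNReal

section Montel

theorem dist_le_of_norm_le_on_ball {g : ℂ → ℂ} {z x : ℂ} {R M : ℝ}
    (hg : DifferentiableOn ℂ g (Metric.ball z R)) (hM : ∀ y ∈ Metric.ball z R, ‖g y‖ ≤ M)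
    (hx : x ∈ Metric.ball z R) : dist (g x) (g z) ≤ 2 * M / R * dist x z := by
  have hz : z ∈ Metric.ball z R := Metric.mem_ball_self (Metric.pos_of_mem_ball hx)
  refine Complex.dist_le_div_mul_dist_of_mapsTo_ball hg (fun y hy => ?_) hx
  rw [Metric.mem_closedBall]
  linarith [dist_le_norm_add_norm (g y) (g z), hM y hy, hM z hz]

theorem equicontinuousAt_of_norm_le_on_ball {ι : Type*} {F : ι → ℂ → ℂ} {z : ℂ} {R M : ℝ}
    (hR : 0 < R) (hF : ∀ i, DifferentiableOn ℂ (F i) (Metric.ball z R))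
    (hM : ∀ i, ∀ y ∈ Metric.ball z R, ‖F i y‖ ≤ M) : EquicontinuousAt F z := by
  refine Metric.equicontinuousAt_of_continuity_modulus (fun x => 2 * M / R * dist x z) ?_ _ ?_
  · have hcont : Continuous fun x => 2 * M / R * dist x z := by fun_prop
    simpa using hcont.tendsto z
  · filter_upwards [Metric.ball_mem_nhds z hR] with x hx i
    rw [dist_comm]
    exact dist_le_of_norm_le_on_ball (hF i) (hM i) hx

theorem isClosed_setOf_holomorphic : IsClosed {f : C(disk, ℂ) |
    ∃ g : ℂ → ℂ, DifferentiableOn ℂ g disk ∧ ∀ z : disk, f z = g z} := by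
  have : LocallyCompactSpace disk := Metric.isOpen_ball.locallyCompactSpace
  let ext (h : C(disk, ℂ)) : ℂ → ℂ := Function.extend Subtype.val h 0
  have hext : ∀ (h : C(disk, ℂ)) (z : disk), ext h z = h z := fun h z =>
    Subtype.val_injective.extend_apply h 0 z
  refine isClosed_iff_forall_filter.2 fun f u hu hus huf => ?_
  have hloc : TendstoLocallyUniformlyOn ext (ext f) u disk := by
    rw [tendstoLocallyUniformlyOn_iff_tendstoLocallyUniformly_comp_coe]
    simp only [hext, Function.comp_def]
    exact ContinuousMap.tendsto_iff_tendstoLocallyUniformly.1 (tendsto_id'.2 huf)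
  refine ⟨ext f, hloc.differentiableOn ?_ Metric.isOpen_ball, fun z => (hext f z).symm⟩
  filter_upwards [le_principal_iff.1 hus] with h ⟨g, hg, hgh⟩
  exact hg.congr fun z hz => (hext h ⟨z, hz⟩).trans (hgh ⟨z, hz⟩)

theorem isClosedEmbedding_val : IsClosedEmbedding fun f : HolD => f.1 :=
  isClosed_setOf_holomorphic.isClosedEmbedding_subtypeVal

theorem continuous_eval : Continuous fun p : HolD × disk => p.1.1 p.2 := by
  have : LocallyCompactSpace disk := Metric.isOpen_ball.locallyCompactSpace
  exact (isClosedEmbedding_val.continuous.comp continuous_fst).eval continuous_snd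

/-- The holomorphic functions on the disk which are bounded by `M m` on the disk of radius
`r m`; these are the normal families of Montel's theorem. -/
def boundedFamily {ι : Type*} (r M : ι → ℝ) : Set HolD :=
  {f | ∀ m, ∀ z : disk, ‖(z : ℂ)‖ ≤ r m → ‖f.1 z‖ ≤ M m}

variable {ι : Type*} {r M : ι → ℝ}

theorem isClosed_boundedFamily : IsClosed (boundedFamily r M) := by
  simp only [boundedFamily, Set.ofPred_forall]
  exact isClosed_iInter fun m => isClosed_iInter fun z => isClosed_iInter fun _ => isClosed_le
    (continuous_eval.comp (Continuous.prodMk_left z)).norm continuous_const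

theorem equicontinuous_boundedFamily (hr : ∀ s < 1, ∃ m, s ≤ r m) :
    Equicontinuous fun (f : boundedFamily r M) (z : disk) => f.1.1 z := by
  intro z
  choose g hg hfg using fun f : HolD => f.2
  have hz : ‖(z : ℂ)‖ < 1 := mem_ball_zero_iff.1 z.2
  set R : ℝ := (1 - ‖(z : ℂ)‖) / 2 with hR
  obtain ⟨m, hm⟩ := hr (‖(z : ℂ)‖ + R) (by linarith)
  have hball : ∀ y ∈ Metric.ball (z : ℂ) R, ‖y‖ ≤ ‖(z : ℂ)‖ + R := fun y hy => by
    linarith [norm_le_norm_add_norm_sub' y (z : ℂ), mem_ball_iff_norm.1 hy]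
  have hsub : Metric.ball (z : ℂ) R ⊆ disk := fun y hy =>
    mem_ball_zero_iff.2 (by linarith [hball y hy])
  have hequi : EquicontinuousAt (fun f : boundedFamily r M => g f.1) (z : ℂ) :=
    equicontinuousAt_of_norm_le_on_ball (by linarith) (fun f => (hg f.1).mono hsub)
      fun f y hy => by
        rw [← hfg f.1 ⟨y, hsub hy⟩]
        exact f.2 m _ ((hball y hy).trans hm)
  simp only [EquicontinuousAt, hfg]
  exact fun U hU => continuous_subtype_val.continuousAt.eventually (hequi U hU)

theorem isCompact_boundedFamily (hr : ∀ s < 1, ∃ m, s ≤ r m) : IsCompact (boundedFamily r M) := by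
  have : LocallyCompactSpace disk := Metric.isOpen_ball.locallyCompactSpace
  have : T2Space (UniformOnFun disk ℂ {K | IsCompact K}) := UniformOnFun.t2Space_of_covering
    (Set.sUnion_eq_univ_iff.2 fun z => ⟨{z}, isCompact_singleton, rfl⟩)
  rw [← isClosed_boundedFamily.closure_eq]
  refine ArzelaAscoli.isCompact_closure_of_isClosedEmbedding (F := fun (f : HolD) z => f.1 z)
    (𝔖 := {K | IsCompact K}) (fun _ hK => hK)
    (ContinuousMap.isUniformEmbedding_toUniformOnFunIsCompact.isClosedEmbedding.comp
      isClosedEmbedding_val)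
    (fun K _ => (equicontinuous_boundedFamily hr).equicontinuousOn K) fun K _ z _ => ?_
  obtain ⟨m, hm⟩ := hr _ (mem_ball_zero_iff.1 z.2)
  exact ⟨Metric.closedBall 0 (M m), isCompact_closedBall _ _, fun f hf =>
    mem_closedBall_zero_iff.2 (hf m z hm)⟩

end Montel

section Criterion

theorem enorm_le_laverage_circle {g : ℂ → ℂ} {r R : ℝ} (hr : 0 ≤ r) (hrR : r < R)
    (hg : DiffContOnCl ℂ g (Metric.ball 0 R)) {z : ℂ} (hz : ‖z‖ ≤ r) :
    ‖g z‖ₑ ≤ ENNReal.ofReal (R / (R - r)) *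
      ⨍⁻ θ in Set.uIoc 0 (2 * Real.pi), ‖g (circleMap 0 R θ)‖ₑ ∂volume := by
  have hR : 0 < R := hr.trans_lt hrR
  rw [← abs_of_pos hR] at hg
  rw [← hg.circleAverage_smul_div (w := z)
    (by rw [mem_ball_zero_iff, abs_of_pos hR]; exact hz.trans_lt hrR),
    Real.circleAverage_eq_intervalAverage, laverage,
    ← lintegral_const_mul' _ _ ENNReal.ofReal_ne_top]
  refine (enorm_integral_le_lintegral_enorm _).trans (lintegral_mono fun θ => ?_)
  rw [enorm_smul]
  gcongr
  rw [← ofReal_norm, norm_div, sub_zero, norm_circleMap_zero, abs_of_pos hR]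
  have hdist : R - r ≤ ‖circleMap 0 R θ - z‖ := by
    have := norm_sub_norm_le (circleMap 0 R θ) z
    rw [norm_circleMap_zero, abs_of_pos hR] at this
    linarith
  have : 0 < R - r := sub_pos.2 hrR
  gcongr

theorem circleMap_mem_disk {R : ℝ} (hR : |R| < 1) (θ : ℝ) : circleMap 0 R θ ∈ disk := by
  rwa [mem_ball_zero_iff, norm_circleMap_zero]

theorem measurable_enorm_circleMap {R : ℝ} (hR : |R| < 1) :
    Measurable fun p : HolD × ℝ => ‖p.1.1 ⟨circleMap 0 R p.2, circleMap_mem_disk hR p.2⟩‖ₑ :=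
  (continuous_eval.comp (continuous_fst.prodMk
    (((continuous_circleMap 0 R).comp continuous_snd).subtype_mk _))).measurable.enorm

theorem lintegral_laverage_circle_le {μ : Measure HolD} [SFinite μ] {R : ℝ} (hR : |R| < 1)
    {B : ℝ≥0∞} (hB : ∀ z : disk, ‖(z : ℂ)‖ = |R| → ∫⁻ f, ‖f.1 z‖ₑ ∂μ ≤ B) :
    ∫⁻ f, ⨍⁻ θ in Set.uIoc 0 (2 * Real.pi),
      ‖f.1 ⟨circleMap 0 R θ, circleMap_mem_disk hR θ⟩‖ₑ ∂volume ∂μ ≤ B := by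
  simp only [laverage]
  rw [lintegral_lintegral_swap (measurable_enorm_circleMap hR).aemeasurable]
  refine (lintegral_mono fun θ => hB _ (norm_circleMap_zero R θ)).trans ?_
  rw [← laverage_eq', setLAverage_const]
  · simp [Real.volume_uIoc, Real.pi_ne_zero]
  · exact Real.volume_uIoc ▸ ENNReal.ofReal_ne_top

theorem measure_exists_norm_gt_le {μ : Measure HolD} [SFinite μ] {r R M : ℝ} (hr : 0 ≤ r)
    (hrR : r < R) (hR : R < 1) (hM : 0 < M) {B : ℝ≥0∞}
    (hB : ∀ z : disk, ‖(z : ℂ)‖ = R → ∫⁻ f, ‖f.1 z‖ₑ ∂μ ≤ B) :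
    μ {f | ∃ z : disk, ‖(z : ℂ)‖ ≤ r ∧ M < ‖f.1 z‖} ≤
      ENNReal.ofReal (R / (R - r)) * B / ENNReal.ofReal M := by
  have hR_abs : |R| = R := abs_of_pos (hr.trans_lt hrR)
  have hR1 : |R| < 1 := hR_abs.symm ▸ hR
  set L : HolD → ℝ≥0∞ := fun f => ⨍⁻ θ in Set.uIoc 0 (2 * Real.pi),
    ‖f.1 ⟨circleMap 0 R θ, circleMap_mem_disk hR1 θ⟩‖ₑ ∂volume with hL
  have hLm : Measurable L := (measurable_enorm_circleMap hR1).lintegral_prod_right'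
  have hsub : {f : HolD | ∃ z : disk, ‖(z : ℂ)‖ ≤ r ∧ M < ‖f.1 z‖} ⊆
      {f | ENNReal.ofReal M ≤ ENNReal.ofReal (R / (R - r)) * L f} := by
    rintro f ⟨z, hz, hMz⟩
    obtain ⟨g, hg, hfg⟩ := f.2
    have hbound := enorm_le_laverage_circle hr hrR
      (hg.diffContOnCl_ball (Metric.closedBall_subset_ball hR)) hz
    simp only [Set.mem_ofPred_eq, hL, hfg] at hMz ⊢
    refine le_trans ?_ hbound
    rw [← ofReal_norm]
    exact ENNReal.ofReal_le_ofReal hMz.le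
  refine (measure_mono hsub).trans ((meas_ge_le_lintegral_div (hLm.const_mul _).aemeasurable
    (by simpa using hM) ENNReal.ofReal_ne_top).trans ?_)
  rw [lintegral_const_mul _ hLm]
  gcongr
  exact lintegral_laverage_circle_le hR1 (hR_abs.symm ▸ hB)

theorem exists_pos_measure_exists_norm_gt_le {S : Set (Measure HolD)} (hS : ∀ μ ∈ S, SFinite μ)
    {r R : ℝ} (hr : 0 ≤ r) (hrR : r < R) (hR : R < 1) {B : ℝ≥0}
    (hB : ∀ μ ∈ S, ∀ z : disk, ‖(z : ℂ)‖ = R → ∫⁻ f, ‖f.1 z‖ₑ ∂μ ≤ B) {δ : ℝ≥0} (hδ : 0 < δ) :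
    ∃ M : ℝ, ∀ μ ∈ S, μ {f | ∃ z : disk, ‖(z : ℂ)‖ ≤ r ∧ M < ‖f.1 z‖} ≤ δ := by
  set c : ℝ := R / (R - r)
  have hc : 0 < c := div_pos (hr.trans_lt hrR) (sub_pos.2 hrR)
  refine ⟨c * (B + 1) / δ, fun μ hμ => ?_⟩
  have := hS μ hμ
  refine (measure_exists_norm_gt_le hr hrR hR (by positivity) (hB μ hμ)).trans ?_
  rw [← ENNReal.ofReal_coe_nnreal, ← ENNReal.ofReal_coe_nnreal, ← ENNReal.ofReal_mul hc.le,
    ← ENNReal.ofReal_div_of_pos (by positivity)]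
  refine ENNReal.ofReal_le_ofReal ?_
  rw [div_le_iff₀ (by positivity), mul_div_cancel₀ _ (by positivity)]
  gcongr
  linarith

theorem isTightMeasureSet_of_lintegral_enorm_le {S : Set (Measure HolD)}
    (hS : ∀ μ ∈ S, SFinite μ)
    (hbound : ∀ r ∈ Set.Ioo (0 : ℝ) 1, ∃ B : ℝ≥0, ∀ μ ∈ S, ∀ z : disk, ‖(z : ℂ)‖ = r →
      ∫⁻ f, ‖f.1 z‖ₑ ∂μ ≤ B) : IsTightMeasureSet S := by
  rw [isTightMeasureSet_iff_exists_isCompact_measure_compl_le]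
  intro ε hε
  obtain ⟨δ, hδ, hsum⟩ := ENNReal.exists_pos_sum_of_countable hε.ne' ℕ
  obtain ⟨u, hu, hu01, hu1⟩ := exists_seq_strictMono_tendsto' (zero_lt_one' ℝ)
  choose! B hB using hbound
  choose M hM using fun m => exists_pos_measure_exists_norm_gt_le hS (hu01 m).1.le
    (hu m.lt_succ_self) (hu01 (m + 1)).2 (hB _ (hu01 (m + 1))) (hδ m)
  refine ⟨boundedFamily u M, isCompact_boundedFamily fun s hs => ?_, fun μ hμ => ?_⟩
  · exact ((hu1.eventually_const_lt hs).mono fun _ => le_of_lt).exists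
  · have hsub : (boundedFamily u M)ᶜ ⊆
        ⋃ m, {f | ∃ z : disk, ‖(z : ℂ)‖ ≤ u m ∧ M m < ‖f.1 z‖} := fun f hf => by
      simpa [boundedFamily] using hf
    calc μ (boundedFamily u M)ᶜ
        ≤ ∑' m, μ {f | ∃ z : disk, ‖(z : ℂ)‖ ≤ u m ∧ M m < ‖f.1 z‖} :=
          (measure_mono hsub).trans (measure_iUnion_le _)
      _ ≤ ∑' m, (δ m : ℝ≥0∞) := ENNReal.tsum_le_tsum fun m => hM m μ hμ
      _ ≤ ε := hsum.le

end Criterion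

end EllipticGinibre

/-! ### The normalised characteristic polynomial -/

namespace EllipticGinibre

section Measurability

variable {n : ℕ}

instance : BorelSpace (Matrix (Fin n) (Fin n) ℂ) :=
  inferInstanceAs (BorelSpace (Fin n → Fin n → ℂ))

instance : SecondCountableTopology (Matrix (Fin n) (Fin n) ℂ) :=
  inferInstanceAs (SecondCountableTopology (Fin n → Fin n → ℂ))

theorem continuous_normCharFun {α : Type*} [TopologicalSpace α] {A : α → Matrix (Fin n) (Fin n) ℂ}
    {z : α → ℂ} (hA : Continuous A) (hz : Continuous z) (t : ℝ) :
    Continuous fun x => normCharFun t (A x) (z x) := by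
  unfold normCharFun
  exact Continuous.mul (Continuous.matrix_det (by fun_prop)) (by fun_prop)

theorem continuous_normCharPoly (t : ℝ) :
    Continuous (normCharPoly t : Matrix (Fin n) (Fin n) ℂ → HolD) :=
  isClosedEmbedding_val.isInducing.continuous_iff.2 <|
    ContinuousMap.continuous_of_continuous_uncurry
      (fun A : Matrix (Fin n) (Fin n) ℂ => (normCharPoly t A).1) <|
        continuous_normCharFun continuous_fst (continuous_subtype_val.comp continuous_snd) t

theorem measurable_ellipticMatrix (t : ℝ) :
    Measurable fun p : Matrix (Fin n) (Fin n) ℂ × Matrix (Fin n) (Fin n) ℂ =>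
      ellipticMatrix t p.1 p.2 := by
  unfold ellipticMatrix
  exact Continuous.measurable (by fun_prop)

end Measurability

section Universality

theorem lintegral_enorm_le_of_integral_norm_sq_le {Ω E : Type*} {mΩ : MeasurableSpace Ω}
    [NormedAddCommGroup E] {P : Measure Ω} [IsProbabilityMeasure P] {f : Ω → E} {C : ℝ}
    (hf : Integrable (fun ω => ‖f ω‖ ^ 2) P) (hC : ∫ ω, ‖f ω‖ ^ 2 ∂P ≤ C) :
    ∫⁻ ω, ‖f ω‖ₑ ∂P ≤ ENNReal.ofReal (1 + C) :=
  have hint : Integrable (fun ω => 1 + ‖f ω‖ ^ 2) P := (integrable_const 1).add hf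
  calc ∫⁻ ω, ‖f ω‖ₑ ∂P
      ≤ ∫⁻ ω, ENNReal.ofReal (1 + ‖f ω‖ ^ 2) ∂P := lintegral_mono fun ω => by
        rw [← ofReal_norm]
        exact ENNReal.ofReal_le_ofReal (by nlinarith [sq_nonneg (‖f ω‖ - 1), norm_nonneg (f ω)])
    _ = ENNReal.ofReal (∫ ω, (1 + ‖f ω‖ ^ 2) ∂P) :=
        (ofReal_integral_eq_lintegral_ofReal hint (ae_of_all _ fun ω => by positivity)).symm
    _ ≤ ENNReal.ofReal (1 + C) := ENNReal.ofReal_le_ofReal <| by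
        rw [integral_add (integrable_const 1) hf]
        simpa using hC

theorem IsElliptic.measurable_matrix {Ω : Type*} [MeasurableSpace Ω] {P : Measure Ω} {t : ℝ}
    {n : ℕ} {A : Ω → Matrix (Fin n) (Fin n) ℂ} (hA : IsElliptic t A P) : Measurable A :=
  measurable_pi_lambda _ fun i => measurable_pi_lambda _ fun j => hA.measurable i j

variable {Ω : ℕ → Type*} [∀ n, MeasurableSpace (Ω n)] {P : ∀ n, Measure (Ω n)}
  [∀ n, IsProbabilityMeasure (P n)] {A : ∀ n, Ω n → Matrix (Fin n) (Fin n) ℂ} {t : ℝ}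

theorem isTightMeasureSet_map_normCharPoly (hA : ∀ n, 1 ≤ n → IsElliptic t (A n) (P n))
    (ht : t ∈ Set.Icc (-1 : ℝ) 1) :
    IsTightMeasureSet {μ : Measure HolD |
      ∃ n : ℕ, 1 ≤ n ∧ μ = (P n).map fun ω => normCharPoly t (A n ω)} := by
  refine isTightMeasureSet_of_lintegral_enorm_le ?_ fun r hr =>
    ⟨(1 + momentBound r).toNNReal, ?_⟩
  · rintro _ ⟨n, _, rfl⟩
    infer_instance
  · rintro _ ⟨n, hn, rfl⟩ z hz
    have heval : Measurable fun f : HolD => ‖f.1 z‖ₑ :=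
      (continuous_eval.comp (Continuous.prodMk_left z)).measurable.enorm
    obtain ⟨hint, hle⟩ := (hA n hn).integral_norm_normCharFun_sq_le (z := (z : ℂ))
      (by omega) ht (norm_pos_iff.1 (hz ▸ hr.1)) (hz ▸ hr.2)
    have hmeas : Measurable fun ω => normCharPoly t (A n ω) :=
      (continuous_normCharPoly t).measurable.comp (hA n hn).measurable_matrix
    rw [lintegral_map heval hmeas]
    exact lintegral_enorm_le_of_integral_norm_sq_le hint (hz ▸ hle)

end Universality

section GaussianModel

variable {n : ℕ}

theorem map_hermitianOf_inl_inr :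
    (Measure.pi fun _ : (Fin n × Fin n) ⊕ (Fin n × Fin n) => gaussianReal 0 1).map
      (fun ω => (hermitianOf fun p => ω (.inl p), hermitianOf fun p => ω (.inr p))) =
        (gue n).prod (gue n) := by
  have hsum := measurePreserving_sumPiEquivProdPi
    (fun _ : (Fin n × Fin n) ⊕ (Fin n × Fin n) => gaussianReal 0 1)
  rw [gue, Measure.map_prod_map _ _ (measurable_hermitianOf n) (measurable_hermitianOf n),
    ← hsum.map_eq, Measure.map_map
      ((measurable_hermitianOf n).prodMap (measurable_hermitianOf n)) hsum.measurable]
  rfl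

theorem map_ellipticMatrix_eq_map_ellipticOf {Ω : Type*} [MeasurableSpace Ω] {P : Measure Ω}
    [IsFiniteMeasure P] {X Y : Ω → Matrix (Fin n) (Fin n) ℂ} (hX : HasLaw X (gue n) P)
    (hY : HasLaw Y (gue n) P) (hXY : IndepFun X Y P) (t : ℝ) :
    P.map (fun ω => ellipticMatrix t (X ω) (Y ω)) =
      (Measure.pi fun _ => gaussianReal 0 1).map (ellipticOf t fun q ω => ω q) := by
  have hmodel : Measurable fun ω : (Fin n × Fin n) ⊕ (Fin n × Fin n) → ℝ =>
      (hermitianOf fun p => ω (.inl p), hermitianOf fun p => ω (.inr p)) :=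
    ((measurable_hermitianOf n).comp (by fun_prop)).prodMk
      ((measurable_hermitianOf n).comp (by fun_prop))
  have hpair : P.map (fun ω => (X ω, Y ω)) = (gue n).prod (gue n) := by
    rw [(indepFun_iff_map_prod_eq_prod_map_map hX.aemeasurable hY.aemeasurable).1 hXY, hX.map_eq,
      hY.map_eq]
  rw [← map_hermitianOf_inl_inr] at hpair
  have hmap := congrArg (Measure.map fun p => ellipticMatrix t p.1 p.2) hpair
  rwa [AEMeasurable.map_map_of_aemeasurable (measurable_ellipticMatrix t).aemeasurable
      (hX.aemeasurable.prodMk hY.aemeasurable),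
    Measure.map_map (measurable_ellipticMatrix t) hmodel] at hmap

end GaussianModel

end EllipticGinibre

end

open EllipticGinibre in
theorem theorem2_general (t : ℝ) (ht : t ∈ Set.Icc (-1 : ℝ) 1)
    {Ω : ℕ → Type*} [∀ n, MeasurableSpace (Ω n)]
    (P : ∀ n, Measure (Ω n)) [∀ n, IsProbabilityMeasure (P n)]
    (X Y : ∀ n, Ω n → Matrix (Fin n) (Fin n) ℂ)
    (hX : ∀ n, 1 ≤ n → HasLaw (X n) (gue n) (P n))
    (hY : ∀ n, 1 ≤ n → HasLaw (Y n) (gue n) (P n))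
    (hXY : ∀ n, 1 ≤ n → IndepFun (X n) (Y n) (P n))
    (f : ∀ n, Ω n → HolD)
    (hf : ∀ n, 1 ≤ n → ∀ ω, f n ω =
      normCharPoly t (ellipticMatrix t (X n ω) (Y n ω))) :
    (∀ n, 1 ≤ n → AEMeasurable (f n) (P n)) ∧
      IsTightMeasureSet {μ : Measure HolD |
        ∃ n : ℕ, 1 ≤ n ∧ μ = (P n).map (f n)} := by
  have hmeas : ∀ n, Measurable (normCharPoly t : Matrix (Fin n) (Fin n) ℂ → HolD) :=
    fun n => (continuous_normCharPoly t).measurable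
  have hA : ∀ n, 1 ≤ n → AEMeasurable (fun ω => ellipticMatrix t (X n ω) (Y n ω)) (P n) :=
    fun n hn => (measurable_ellipticMatrix t).comp_aemeasurable
      ((hX n hn).aemeasurable.prodMk (hY n hn).aemeasurable)
  have hmodel : ∀ n, IsElliptic t (ellipticOf (n := n) t fun q ω => ω q)
      (Measure.pi fun _ => gaussianReal 0 1) :=
    fun n => isElliptic_ellipticOf (isStdGaussianFamily_eval _) ht
  have hfun : ∀ n, 1 ≤ n → f n = normCharPoly t ∘ fun ω => ellipticMatrix t (X n ω) (Y n ω) :=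
    fun n hn => funext (hf n hn)
  refine ⟨fun n hn => hfun n hn ▸ (hmeas n).comp_aemeasurable (hA n hn),
    (isTightMeasureSet_map_normCharPoly (fun n _ => hmodel n) ht).subset ?_⟩
  rintro _ ⟨n, hn, rfl⟩
  refine ⟨n, hn, ?_⟩
  rw [hfun n hn, ← AEMeasurable.map_map_of_aemeasurable (hmeas n).aemeasurable (hA n hn),
    map_ellipticMatrix_eq_map_ellipticOf (hX n hn) (hY n hn) (hXY n hn) t,
    Measure.map_map (hmeas n) (hmodel n).measurable_matrix]
  rfl

theorem theorem2 (t : ℝ) (ht : t ∈ Set.Icc (0 : ℝ) 1)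
    {Ω : ℕ → Type*} [∀ n, MeasurableSpace (Ω n)]
    (P : ∀ n, Measure (Ω n)) [∀ n, IsProbabilityMeasure (P n)]
    (X Y : ∀ n, Ω n → Matrix (Fin n) (Fin n) ℂ)
    (hX : ∀ n, 1 ≤ n → HasLaw (X n) (EllipticGinibre.gue n) (P n))
    (hY : ∀ n, 1 ≤ n → HasLaw (Y n) (EllipticGinibre.gue n) (P n))
    (hXY : ∀ n, 1 ≤ n → IndepFun (X n) (Y n) (P n))
    (f : ∀ n, Ω n → EllipticGinibre.HolD)
    (hf : ∀ n, 1 ≤ n → ∀ ω, f n ω =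
      EllipticGinibre.normCharPoly t (EllipticGinibre.ellipticMatrix t (X n ω) (Y n ω))) :
    (∀ n, 1 ≤ n → AEMeasurable (f n) (P n)) ∧
      IsTightMeasureSet {μ : Measure EllipticGinibre.HolD |
        ∃ n : ℕ, 1 ≤ n ∧ μ = (P n).map (f n)} :=
  theorem2_general t ⟨by linarith [ht.1], ht.2⟩ P X Y hX hY hXY f hf
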